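/- A \emph{3-manifold triangulation of size $n$} consists of $n$ tetrahedra whose $4n$ faces are affinely identified in $2n$ pairs (two faces of the same tetrahedron may be paired) so that the resulting quotient space is a connected closed 3-manifold. Two such triangulations are \emph{isomorphic} if they are identical up to a relabelling of the tetrahedra and a reordering of the four vertices of each tetrahedron. Let $V_n$ be the number of isomorphism classes of 3-manifold triangulations of size $n$. \textbf{Theorem.} $V_n$ grows at an asymptotic rate of $\exp(\Theta(n\log n))$; that is, there are constants $c, C > 0$ and $N \in \mathbb{N}$ such that \[ \exp(c\, n\log n) \;\le\; V_n \;\le\; \exp(C\, n\log n) \qquad\text{for all } n \ge N. \] -/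

import Mathlib

/-- A pairwise gluing of the `4 * n` faces of `n` tetrahedra labelled by `Fin n`.
The vertices of every tetrahedron are labelled by `Fin 4`, and `(t, v)` stands for the face of the
tetrahedron `t` opposite its vertex `v`.  This face is glued to the face
`(adj t v, perm t v v)`; the affine identification of the two faces sends the vertex `w ≠ v`
of the tetrahedron `t` to the vertex `perm t v w` of the tetrahedron `adj t v`.
(As `perm t v` sends the vertex `v` opposite the first face to the vertex opposite the second,
it carries no information beyond the two faces and the bijection between their vertices.)
The last three fields say that the glued faces form pairs of two different faces, and that the
two identifications recorded for a pair are inverse to each other. -/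
@[ext]
structure FaceGluing (n : ℕ) where
  adj : Fin n → Fin 4 → Fin n
  perm : Fin n → Fin 4 → Equiv.Perm (Fin 4)
  adj_adj : ∀ t v, adj (adj t v) (perm t v v) = t
  perm_adj : ∀ t v, perm (adj t v) (perm t v v) = (perm t v)⁻¹
  ne_self : ∀ t v, (adj t v, perm t v v) ≠ (t, v)

namespace FaceGluing

/-- The elementary identifications of points of the disjoint union of `n` tetrahedra, in
barycentric coordinates: a point of the face `(t, v)`, that is a point `x` of the tetrahedron `t`
with `x v = 0`, is identified with its image in the tetrahedron `adj t v` under the affine map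
that is given on vertices by `perm t v`. -/
def Identified {n : ℕ} (G : FaceGluing n) (p q : Fin n × stdSimplex ℝ (Fin 4)) : Prop :=
  ∃ v : Fin 4, p.2.1 v = 0 ∧ q.1 = G.adj p.1 v ∧ ∀ w, q.2.1 (G.perm p.1 v w) = p.2.1 w

/-- The topological space obtained from the disjoint union of `n` tetrahedra by the gluing, with
the quotient topology (by the equivalence relation that the identifications generate). -/
def Realization {n : ℕ} (G : FaceGluing n) : Type :=
  Quot G.Identified

instance {n : ℕ} (G : FaceGluing n) : TopologicalSpace G.Realization :=
  inferInstanceAs (TopologicalSpace (Quot G.Identified))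

end FaceGluing

/-- `X` is a connected closed topological 3-manifold: a non-empty connected compact second
countable Hausdorff space that is locally homeomorphic to `ℝ³` (so without boundary). -/
structure IsConnectedClosedThreeManifold (X : Type) [TopologicalSpace X] : Prop where
  connected : ConnectedSpace X
  compact : CompactSpace X
  secondCountable : SecondCountableTopology X
  hausdorff : T2Space X
  locallyEuclidean : Nonempty (ChartedSpace (EuclideanSpace ℝ (Fin 3)) X)

/-- The (labelled) 3-manifold triangulations of size `n`: gluings of the faces of `n` tetrahedra
in pairs such that the resulting space is a connected closed 3-manifold. -/
abbrev ThreeManifoldTriangulation (n : ℕ) : Type :=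
  {G : FaceGluing n // IsConnectedClosedThreeManifold G.Realization}

namespace ThreeManifoldTriangulation

/-- Two triangulations are isomorphic if they are identical up to a relabelling `σ` of the
tetrahedra and reorderings `τ t` of the four vertices of each tetrahedron `t`. -/
def Isomorphic {n : ℕ} (S T : ThreeManifoldTriangulation n) : Prop :=
  ∃ (σ : Equiv.Perm (Fin n)) (τ : Fin n → Equiv.Perm (Fin 4)), ∀ t v,
    T.1.adj (σ t) (τ t v) = σ (S.1.adj t v) ∧
      ∀ w, T.1.perm (σ t) (τ t v) (τ t w) = τ (S.1.adj t v) (S.1.perm t v w)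

theorem isomorphic_equivalence (n : ℕ) :
    Equivalence (Isomorphic : ThreeManifoldTriangulation n → ThreeManifoldTriangulation n → Prop)
    where
  refl _ := ⟨1, fun _ => 1, fun _ _ => ⟨rfl, fun _ => rfl⟩⟩
  symm := by
    rintro S T ⟨σ, τ, h⟩
    refine ⟨σ.symm, fun t => (τ (σ.symm t)).symm, fun t v => ?_⟩
    obtain ⟨h1, h2⟩ := h (σ.symm t) ((τ (σ.symm t)).symm v)
    simp only [Equiv.apply_symm_apply] at h1 h2
    refine ⟨by rw [h1, Equiv.symm_apply_apply], fun w => ?_⟩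
    have h3 := h2 ((τ (σ.symm t)).symm w)
    rw [Equiv.apply_symm_apply] at h3
    simp only [h3, h1, Equiv.symm_apply_apply]
  trans := by
    rintro S T U ⟨σ, τ, h⟩ ⟨σ', τ', h'⟩
    refine ⟨σ.trans σ', fun t => (τ t).trans (τ' (σ t)), fun t v => ⟨?_, fun w => ?_⟩⟩
    · simp only [Equiv.trans_apply]
      rw [(h' (σ t) (τ t v)).1, (h t v).1]
    · simp only [Equiv.trans_apply]
      rw [(h' (σ t) (τ t v)).2, (h t v).1, (h t v).2]

instance isomorphismSetoid (n : ℕ) : Setoid (ThreeManifoldTriangulation n) :=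
  ⟨Isomorphic, isomorphic_equivalence n⟩

/-- The isomorphism classes of 3-manifold triangulations of size `n`. -/
abbrev IsoClass (n : ℕ) : Type :=
  Quotient (isomorphismSetoid n)

/-- There are only finitely many, so that `Nat.card` counts them. -/
instance finite_isoClass (n : ℕ) : Finite (IsoClass n) := by
  have h1 : Finite (FaceGluing n) :=
    Finite.of_injective (fun G : FaceGluing n => (G.adj, G.perm)) fun G H h =>
      FaceGluing.ext (Prod.ext_iff.1 h).1 (Prod.ext_iff.1 h).2
  have h2 : Finite (ThreeManifoldTriangulation n) := Subtype.finite
  exact Quotient.finite _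

/-- The number of isomorphism classes of 3-manifold triangulations of size `n`. -/
noncomputable def numIsoClasses (n : ℕ) : ℕ :=
  Nat.card (IsoClass n)

end ThreeManifoldTriangulation

/-!
The upper bound is a count of all gluings: each of the `4 * n` faces is sent to a tetrahedron, with
a permutation of four labels, so there are at most `((24 * n) ^ 4) ^ n` of them.

For the lower bound, every pair of permutations `s, g` of the `n` tetrahedra defines a gluing
`braidGluing s g`: the face opposite vertex `0` of `t` is glued to the face opposite vertex `3` of
`s t`, and the face opposite vertex `1` of `t` to the face opposite vertex `2` of `g t`, always
preserving the order of the vertices.  For `n = 1` this is a one-tetrahedron triangulation of the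
3-sphere, in which the edge `03` is a knotted loop (a trefoil) and the other five edges form a
single class; crossing the five faces around that class gives the relation `g s g = s²`.  So if
`g s g = s²` (that is, `(g s)² = s³`, the braid group on three strands), the gluing is a branched
cover of the 3-sphere over the trefoil, and its realization is a closed 3-manifold, whatever the
branching: the link of the vertex that belongs to a `g`-cycle of length `k` is a `k`-gonal antiprism
with two pyramidal caps, a sphere.

This is proved with explicit charts (`exists_vertex_chart`).  Since the gluing respects the order of
the vertices, a neighbourhood of a vertex can be enlarged at the expense of the others along this
order by a parameter `c` (`depth`), so that these neighbourhoods cover the realization and no other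
charts are needed.  In a neighbourhood the chart is the cone over the antiprism in cylindrical
coordinates; it is injective because two coordinate vectors with the same image are related by
moving through faces (`HasCylCoords.unique`), it is onto (`exists_hasCylCoords`), and it is proper.
The functions that define a chart extend continuously to the whole realization and separate points,
which gives the Hausdorff property.

To have many triangulations, write `g = x * s⁻¹` with `s ^ 3 = 1` and `x ^ 2 = 1`, fix `s`, and fix
`x` outside a set of about `n / 3` points so that the action is already transitive
(`exists_hasFrame`).  On those points `x` may exchange two halves by any bijection, which gives `h!`
gluings with `12 * h ≥ n`.  An isomorphism is determined by the image of one tetrahedron, since it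
propagates along the common part; so each isomorphism class contains at most `24 * n` of them
(`factorial_le`).
-/

/-! ### The gluing of a pair of permutations -/

/-- The identification of the face opposite `v` in `braidGluing`, as a permutation of the vertex
labels.  Restricted to the labels other than `v` it preserves the order. -/
def facePerm : Fin 4 → Equiv.Perm (Fin 4) :=
  ![(finRotate 4)⁻¹, Equiv.swap 1 2, Equiv.swap 1 2, finRotate 4]

theorem facePerm_facePerm (v : Fin 4) : facePerm (facePerm v v) = (facePerm v)⁻¹ := by
  revert v; decide

/-- The tetrahedron that `braidGluing` puts behind the face opposite `v`, as a permutation of the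
tetrahedra. -/
def faceStep {T : Type*} (s g : Equiv.Perm T) : Fin 4 → Equiv.Perm T := ![s, g, g⁻¹, s⁻¹]

theorem faceStep_facePerm {T : Type*} (s g : Equiv.Perm T) (v : Fin 4) :
    faceStep s g (facePerm v v) = (faceStep s g v)⁻¹ := by
  have h : ∀ v, facePerm v v = ![3, 2, 1, 0] v := by decide
  rw [h]
  fin_cases v <;> simp [faceStep]

/-- The gluing in which the faces opposite `0` and `1` of `t` are glued to the faces opposite `3` of
`s t` and opposite `2` of `g t`. -/
def braidGluing {n : ℕ} (s g : Equiv.Perm (Fin n)) : FaceGluing n where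
  adj t v := faceStep s g v t
  perm _ v := facePerm v
  adj_adj t v := by rw [faceStep_facePerm]; simp
  perm_adj _ v := facePerm_facePerm v
  ne_self t v h := by
    have h1 : ∀ v, facePerm v v ≠ v := by decide
    exact h1 v (Prod.ext_iff.1 h).2

/-! ### Neighbourhoods of the vertices -/

/-- The weights in `depth`: `c` for the labels above `j`, and `c⁻¹` for the labels below `j`. -/
noncomputable def cornerWeight (c : ℝ) (j l : Fin 4) : ℝ :=
  if l = j then 0 else if j < l then c else c⁻¹

/-- How far the point `x` of a tetrahedron, in barycentric coordinates, lies inside the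
neighbourhood `{x | 0 < depth c j x}` of the vertex `j`.  For small `c` the smaller labels have
larger neighbourhoods; which label is smaller is invariant under the gluing maps, so the
neighbourhoods in different tetrahedra fit together. -/
noncomputable def depth (c : ℝ) (j : Fin 4) (x : Fin 4 → ℝ) : ℝ :=
  x j - ∑ l, cornerWeight c j l * x l

theorem cornerWeight_nonneg {c : ℝ} (hc : 0 < c) (j l : Fin 4) : 0 ≤ cornerWeight c j l := by
  unfold cornerWeight; split_ifs <;> positivity

theorem cornerWeight_le {c : ℝ} (hc : 0 < c) (j l : Fin 4) : cornerWeight c j l ≤ c + c⁻¹ := by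
  have := inv_pos.2 hc
  unfold cornerWeight; split_ifs <;> linarith

theorem cornerWeight_facePerm (c : ℝ) {v j l : Fin 4} (hj : j ≠ v) (hl : l ≠ v) :
    cornerWeight c (facePerm v j) (facePerm v l) = cornerWeight c j l := by
  have h : ∀ v j l : Fin 4, j ≠ v → l ≠ v →
      ((facePerm v l = facePerm v j ↔ l = j) ∧ (facePerm v j < facePerm v l ↔ j < l)) := by decide
  obtain ⟨h1, h2⟩ := h v j l hj hl
  simp only [cornerWeight, h1, h2]

theorem depth_facePerm (c : ℝ) {v j : Fin 4} (hj : j ≠ v) {x y : Fin 4 → ℝ} (hx : x v = 0)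
    (hy : ∀ w, y (facePerm v w) = x w) : depth c (facePerm v j) y = depth c j x := by
  unfold depth
  rw [hy, ← Equiv.sum_comp (facePerm v)]
  congr 1
  refine Finset.sum_congr rfl fun l _ => ?_
  rw [hy]
  by_cases hl : l = v
  · rw [hl, hx, mul_zero, mul_zero]
  · rw [cornerWeight_facePerm c hj hl]

theorem sum_cornerWeight_nonneg {c : ℝ} (hc : 0 < c) (j : Fin 4) {x : Fin 4 → ℝ}
    (hx : ∀ l, 0 ≤ x l) :
    0 ≤ ∑ l, cornerWeight c j l * x l :=
  Finset.sum_nonneg fun l _ => mul_nonneg (cornerWeight_nonneg hc j l) (hx l)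

theorem depth_le {c : ℝ} (hc : 0 < c) (j : Fin 4) {x : Fin 4 → ℝ} (hx : ∀ l, 0 ≤ x l) :
    depth c j x ≤ x j := by
  have := sum_cornerWeight_nonneg hc j hx
  unfold depth; linarith

/-- The neighbourhoods of two vertices of a tetrahedron are disjoint, as their weights for each
other are inverse. -/
theorem depth_nonpos_of_pos {c : ℝ} (hc : 0 < c) {j l : Fin 4} (hjl : j ≠ l) {x : Fin 4 → ℝ}
    (hx : ∀ l, 0 ≤ x l) (h : 0 < depth c j x) : depth c l x ≤ 0 := by
  have key : ∀ j l, cornerWeight c j l * x l ≤ ∑ l, cornerWeight c j l * x l := fun j l =>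
    Finset.single_le_sum (f := fun l => cornerWeight c j l * x l)
      (fun l _ => mul_nonneg (cornerWeight_nonneg hc j l) (hx l)) (Finset.mem_univ l)
  have h1 := key j l
  have h2 := key l j
  have h3 : cornerWeight c j l * cornerWeight c l j = 1 := by
    rcases lt_or_gt_of_ne hjl with h | h <;>
      simp [cornerWeight, hjl, hjl.symm, h, h.not_gt, hc.ne']
  unfold depth at h ⊢
  have h4 : cornerWeight c l j * (cornerWeight c j l * x l) = x l := by
    rw [← mul_assoc, mul_comm (cornerWeight c l j), h3, one_mul]
  have h5 : cornerWeight c l j * (cornerWeight c j l * x l) ≤ cornerWeight c l j * x j :=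
    mul_le_mul_of_nonneg_left (by linarith) (cornerWeight_nonneg hc l j)
  linarith

/-- Every point of a tetrahedron lies in one of the neighbourhoods, once `c` is small enough. -/
theorem exists_depth_pos {x : Fin 4 → ℝ} (hx : x ∈ stdSimplex ℝ (Fin 4)) :
    ∃ c : ℝ, 0 < c ∧ ∃ j, 0 < depth c j x := by
  obtain ⟨h0, h1⟩ := hx
  have hex : ∃ j, 0 < x j := by
    by_contra! h
    have : ∑ j, x j ≤ 0 := Finset.sum_nonpos fun j _ => h j
    linarith
  -- the first vertex with a positive coordinate
  obtain ⟨j, hj, hmin⟩ : ∃ j, 0 < x j ∧ ∀ l < j, x l = 0 := by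
    obtain ⟨j, hj⟩ := exists_minimal_of_wellFoundedLT (fun j => 0 < x j) hex
    refine ⟨j, hj.prop, fun l hl => le_antisymm ?_ (h0 l)⟩
    by_contra! h
    exact absurd (hj.le_of_le h hl.le) hl.not_ge
  refine ⟨x j / 2, by positivity, j, ?_⟩
  have : ∑ l, cornerWeight (x j / 2) j l * x l ≤ ∑ l, x j / 2 * x l := by
    refine Finset.sum_le_sum fun l _ => ?_
    rcases lt_trichotomy l j with h | h | h
    · rw [hmin l h]; simp
    · simp only [cornerWeight, h, if_true, zero_mul]; positivity
    · simp [cornerWeight, h, h.ne']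
  rw [← Finset.mul_sum, h1] at this
  unfold depth; linarith

theorem continuous_depth (c : ℝ) (j : Fin 4) : Continuous (depth c j) := by
  unfold depth; fun_prop

/-! ### The cone over the link of a vertex -/

/-- For `r ≥ 0`, the complex number of modulus `r` and argument `κ * (m / r)`.  In this
parametrization of a cone, `m` is the arc length on the circle of radius `r`, in the unit for which
a step of angle `κ` has length `r`; it is continuous at `r = 0`, where it vanishes. -/
noncomputable def polar (κ r m : ℝ) : ℂ := r * Complex.exp ((κ * (m / r) : ℝ) * Complex.I)

theorem norm_polar (κ r m : ℝ) : ‖polar κ r m‖ = |r| := by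
  rw [polar, norm_mul, Complex.norm_exp_ofReal_mul_I, mul_one, Complex.norm_real, Real.norm_eq_abs]

theorem polar_mul (κ : ℝ) {a : ℝ} (ha : a ≠ 0) (r m : ℝ) : polar κ (a * r) (a * m) =
    a * polar κ r m := by
  rw [polar, polar, mul_div_mul_left _ _ ha, Complex.ofReal_mul, mul_assoc]

/-- Adding `r` to `m` turns by the angle `κ`. -/
theorem polar_add (κ r m a : ℝ) : polar κ r (m + a * r) =
    Complex.exp ((κ * a : ℝ) * Complex.I) * polar κ r m := by
  rcases eq_or_ne r 0 with rfl | hr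
  · simp [polar]
  · rw [polar, polar, add_div, mul_div_assoc, div_self hr, mul_one, mul_add]
    push_cast
    rw [add_mul, Complex.exp_add]; ring

theorem continuous_polar (κ : ℝ) : Continuous fun q : ℝ × ℝ => polar κ q.1 q.2 := by
  rw [continuous_iff_continuousAt]
  rintro ⟨r, m⟩
  rcases eq_or_ne r 0 with rfl | hr
  · rw [ContinuousAt, show polar κ (0, m).1 (0, m).2 = 0 by simp [polar]]
    rw [tendsto_zero_iff_norm_tendsto_zero]
    simp only [norm_polar]
    have : Continuous fun q : ℝ × ℝ => |q.1| := by fun_prop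
    simpa using this.tendsto (0, m)
  · unfold polar
    have : ContinuousAt (fun q : ℝ × ℝ => q.2 / q.1) (r, m) := by
      refine ContinuousAt.div (by fun_prop) (by fun_prop) hr
    fun_prop

/-- The distance from the axis of the image of a point of the corner at the vertex `j`.

Together with `cornerTwist` and `cornerHeight` this describes the corners `0, …, 3` as the cones
over the triangles of an antiprism with caps: a triangle of the upper cap, a triangle of the band
with its base above, one with its base below, and a triangle of the lower cap.  The edges from `0`
to `3` lie on the axis, and the coordinate `j` is ignored. -/
noncomputable def cornerRadius (j : Fin 4) (x : Fin 4 → ℝ) : ℝ :=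
  ![x 1 + x 2, x 0 + x 2 + x 3, x 0 + x 1 + x 3, x 1 + x 2] j

/-- The arc length that separates the image of a point of the corner at `j` from the reference
direction of its tetrahedron. -/
noncomputable def cornerTwist (j : Fin 4) (x : Fin 4 → ℝ) : ℝ :=
  ![x 2, x 3 + x 0 / 2, (x 1 - x 0) / 2, (x 2 - x 1) / 2] j

/-- The height along the axis of the image of a point of the corner at `j`. -/
noncomputable def cornerHeight (j : Fin 4) (x : Fin 4 → ℝ) : ℝ :=
  ![x 1 + x 2 + x 3, x 2 + x 3 - x 0, x 3 - x 0 - x 1, -(x 0 + x 1 + x 2)] j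

/-- The map of the corner at `j` to `ℂ × ℝ`, with reference direction `ω`, where one step around the
axis is a rotation by the angle `κ`. -/
noncomputable def cornerMap (κ : ℝ) (ω : ℂ) (j : Fin 4) (x : Fin 4 → ℝ) : ℂ × ℝ :=
  (ω * polar κ (cornerRadius j x) (cornerTwist j x), cornerHeight j x)

theorem continuous_cornerMap (κ : ℝ) (ω : ℂ) (j : Fin 4) : Continuous (cornerMap κ ω j) := by
  have h1 : Continuous (cornerRadius j) := by unfold cornerRadius; fin_cases j <;> simp <;> fun_prop
  have h2 : Continuous (cornerTwist j) := by unfold cornerTwist; fin_cases j <;> simp <;> fun_prop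
  have h3 : Continuous (cornerHeight j) := by unfold cornerHeight; fin_cases j <;> simp <;> fun_prop
  unfold cornerMap
  exact (continuous_const.mul ((continuous_polar κ).comp (h1.prodMk h2))).prodMk h3

/-- The maximum of radius and absolute height is the sum of the coordinates other than `j`; this
makes the charts proper. -/
theorem norm_cornerMap (κ : ℝ) {ω : ℂ} (hω : ‖ω‖ = 1) (j : Fin 4) {x : Fin 4 → ℝ}
    (hx : ∀ l, 0 ≤ x l) :
    ‖cornerMap κ ω j x‖ = ∑ l, if l = j then 0 else x l := by
  have h0 := hx 0
  have h1 := hx 1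
  have h2 := hx 2
  have h3 := hx 3
  rw [cornerMap, Prod.norm_def, norm_mul, hω, one_mul, norm_polar, Real.norm_eq_abs,
    Fin.sum_univ_four]
  fin_cases j <;> simp [cornerRadius, cornerHeight]
  · rw [abs_of_nonneg (by positivity), abs_of_nonneg (by positivity), max_eq_right (by linarith)]
  · rw [abs_of_nonneg (by positivity), max_eq_left (abs_le.2 ⟨by linarith, by linarith⟩)]
  · rw [abs_of_nonneg (by positivity), max_eq_left (abs_le.2 ⟨by linarith, by linarith⟩)]
  · rw [abs_of_nonneg (by positivity), abs_of_nonpos (by linarith), max_eq_right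
      (by linarith)]
    linarith

/-- `cornerMap` is homogeneous, and does not depend on the coordinate `j`. -/
theorem cornerMap_smul (κ : ℝ) (ω : ℂ) (j : Fin 4) {a : ℝ} (ha : a ≠ 0) {x b : Fin 4 → ℝ}
    (h : ∀ l, l ≠ j → x l = a * b l) : cornerMap κ ω j x = a • cornerMap κ ω j b := by
  have key : cornerRadius j x = a * cornerRadius j b ∧ cornerTwist j x = a * cornerTwist j b ∧
      cornerHeight j x = a * cornerHeight j b := by
    have h0 := h 0
    have h1 := h 1
    have h2 := h 2
    have h3 := h 3
    fin_cases j <;> simp at h0 h1 h2 h3 <;>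
      simp only [cornerRadius, cornerTwist, cornerHeight, h0, h1, h2, h3, Fin.zero_eta, Fin.mk_one,
        Fin.reduceFinMk, Matrix.cons_val] <;>
      refine ⟨?_, ?_, ?_⟩ <;> first | trivial | ring
  rw [cornerMap, cornerMap, key.1, key.2.1, key.2.2, polar_mul κ ha, Prod.smul_mk]
  simp only [Complex.real_smul, smul_eq_mul]
  congr 1
  ring

section
variable {n : ℕ} {s g : Equiv.Perm (Fin n)}

/-! ### The corner maps fit together on the realization -/

/-- The cube of `s` is central: it equals `(g s)²`. -/
theorem pow_three_comm {T : Type*} {s g : Equiv.Perm T} (hsg : ∀ t, g (s (g t)) = s (s t)) (t : T) :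
    s (s (s (g t))) = g (s (s (s t))) := by
  rw [← hsg (s (g t)), ← hsg t]

/-- The depth of a point in the neighbourhood of the vertex whose corners are the `(t, j)` with
`s ^ j t` in the support of `ω`; here `ω` has absolute value `1` on a cycle of `g` and vanishes
elsewhere.  At most one summand is not zero. -/
noncomputable def totalDepth (c : ℝ) (s : Equiv.Perm (Fin n)) (ω : Fin n → ℂ)
    (p : Fin n × stdSimplex ℝ (Fin 4)) : ℝ :=
  ∑ j : Fin 4, ‖ω ((s ^ (j : ℕ)) p.1)‖ * max (depth c j p.2.1) 0

/-- The corner maps around a vertex, multiplied by the depth, so that they extend by zero. -/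
noncomputable def totalMap (κ c : ℝ) (s : Equiv.Perm (Fin n)) (ω : Fin n → ℂ)
    (p : Fin n × stdSimplex ℝ (Fin 4)) : ℂ × ℝ :=
  ∑ j : Fin 4, (‖ω ((s ^ (j : ℕ)) p.1)‖ * max (depth c j p.2.1) 0) •
    cornerMap κ (ω ((s ^ (j : ℕ)) p.1)) j p.2.1

theorem cornerMap_facePerm_zero (κ : ℝ) (ω : ℂ) {j : Fin 4} (hj : j ≠ 0) {x y : Fin 4 → ℝ}
    (hx : x 0 = 0) (hy : ∀ w, y (facePerm 0 w) = x w) :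
    cornerMap κ ω (facePerm 0 j) y = cornerMap κ ω j x := by
  have e : (facePerm 0 0 = 3 ∧ facePerm 0 1 = 0) ∧ facePerm 0 2 = 1 ∧ facePerm 0 3 = 2 := by decide
  obtain ⟨⟨e0, e1⟩, e2, e3⟩ := e
  have h0 := hy 0
  have h1 := hy 1
  have h2 := hy 2
  have h3 := hy 3
  rw [e0, hx] at h0
  rw [e1] at h1
  rw [e2] at h2
  rw [e3] at h3
  have key : cornerRadius (facePerm 0 j) y = cornerRadius j x ∧
      cornerTwist (facePerm 0 j) y = cornerTwist j x ∧
      cornerHeight (facePerm 0 j) y = cornerHeight j x := by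
    fin_cases j
    · exact absurd rfl hj
    all_goals
      simp only [Fin.mk_one, Fin.reduceFinMk, e1, e2, e3, cornerRadius, cornerTwist, cornerHeight,
        Matrix.cons_val, h0, h1, h2, h3, hx]
      refine ⟨?_, ?_, ?_⟩ <;> first | trivial | ring
  rw [cornerMap, cornerMap, key.1, key.2.1, key.2.2]

theorem cornerMap_facePerm_one (κ : ℝ) {ω ω' : ℂ} {j : Fin 4} (hj : j ≠ 1)
    (hω : if j = 2 then ω = Complex.exp (κ * Complex.I) * ω'
      else ω' = Complex.exp (κ * Complex.I) * ω) {x y : Fin 4 → ℝ}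
    (hx : x 1 = 0) (hy : ∀ w, y (facePerm 1 w) = x w) :
    cornerMap κ ω' (facePerm 1 j) y = cornerMap κ ω j x := by
  have e : (facePerm 1 0 = 0 ∧ facePerm 1 1 = 2) ∧ facePerm 1 2 = 1 ∧ facePerm 1 3 = 3 := by decide
  obtain ⟨⟨e0, e1⟩, e2, e3⟩ := e
  have h0 := hy 0
  have h1 := hy 1
  have h2 := hy 2
  have h3 := hy 3
  rw [e0] at h0
  rw [e1, hx] at h1
  rw [e2] at h2
  rw [e3] at h3
  have key : cornerRadius (facePerm 1 j) y = cornerRadius j x ∧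
      cornerTwist (facePerm 1 j) y = cornerTwist j x +
        (if j = 2 then 1 else -1) * cornerRadius j x ∧
      cornerHeight (facePerm 1 j) y = cornerHeight j x := by
    fin_cases j
    · simp [e0, cornerRadius, cornerTwist, cornerHeight, h0, h1, h2, h3, hx]
    · exact absurd rfl hj
    · simp [e2, cornerRadius, cornerTwist, cornerHeight, h0, h1, h2, h3, hx]
      ring
    · simp [e3, cornerRadius, cornerTwist, cornerHeight, h0, h1, h2, h3, hx]
      ring
  rw [cornerMap, cornerMap, key.1, key.2.1, key.2.2, polar_add]
  congr 1
  split_ifs at hω ⊢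
  · rw [hω, mul_one]; ring
  · rw [hω, mul_neg_one, Complex.ofReal_neg, neg_mul, Complex.exp_neg]
    field_simp

/-- Across the faces opposite `0` and `1`, a corner and the corner it is glued to have reference
directions for which their maps agree.  For `v = 1` and `j = 2` this is where the relation
`g s g = s²` is needed. -/
theorem corner_compat (hsg : ∀ t, g (s (g t)) = s (s t)) (κ : ℝ) {ω : Fin n → ℂ}
    (hω : ∀ t, ω (g t) = Complex.exp (κ * Complex.I) * ω t) {v j : Fin 4} (hv : v = 0 ∨ v = 1)
    (hj : j ≠ v) (t : Fin n) {x y : Fin 4 → ℝ} (hx : x v = 0) (hy : ∀ w, y (facePerm v w) = x w) :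
    ‖ω ((s ^ (facePerm v j : ℕ)) (faceStep s g v t))‖ = ‖ω ((s ^ (j : ℕ)) t)‖ ∧
      cornerMap κ (ω ((s ^ (facePerm v j : ℕ)) (faceStep s g v t))) (facePerm v j) y =
        cornerMap κ (ω ((s ^ (j : ℕ)) t)) j x := by
  rcases hv with rfl | rfl
  · have e : (s ^ (facePerm 0 j : ℕ)) (faceStep s g 0 t) = (s ^ (j : ℕ)) t := by
      have : ∀ j : Fin 4, j ≠ 0 → (facePerm 0 j : ℕ) + 1 = j := by decide
      rw [← this j hj, pow_succ]; rfl
    rw [e]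
    exact ⟨rfl, cornerMap_facePerm_zero κ _ hj hx hy⟩
  · have e : if j = 2 then
          ω ((s ^ (j : ℕ)) t) = Complex.exp (κ * Complex.I) *
            ω ((s ^ (facePerm 1 j : ℕ)) (faceStep s g 1 t))
        else ω ((s ^ (facePerm 1 j : ℕ)) (faceStep s g 1 t)) =
          Complex.exp (κ * Complex.I) * ω ((s ^ (j : ℕ)) t) := by
      fin_cases j
      · simpa [facePerm, faceStep, Equiv.swap_apply_of_ne_of_ne] using hω t
      · exact absurd rfl hj
      · simp [facePerm, faceStep, ← hω, hsg, pow_two]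
      · simp [facePerm, faceStep, ← hω, pow_succ, pow_three_comm hsg, Equiv.swap_apply_of_ne_of_ne]
    refine ⟨?_, cornerMap_facePerm_one κ hj e hx hy⟩
    split_ifs at e <;> rw [e, norm_mul, Complex.norm_exp_ofReal_mul_I, one_mul]

theorem identified_symm {n : ℕ} {G : FaceGluing n} {p q : Fin n × stdSimplex ℝ (Fin 4)} {v : Fin 4}
    (h0 : p.2.1 v = 0) (h1 : q.1 = G.adj p.1 v) (h2 : ∀ w, q.2.1 (G.perm p.1 v w) = p.2.1 w) :
    q.2.1 (G.perm p.1 v v) = 0 ∧ p.1 = G.adj q.1 (G.perm p.1 v v) ∧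
      ∀ w, p.2.1 (G.perm q.1 (G.perm p.1 v v) w) = q.2.1 w := by
  refine ⟨by rw [h2, h0], by rw [h1, G.adj_adj], fun w => ?_⟩
  rw [h1, G.perm_adj, ← h2, Equiv.Perm.coe_inv, Equiv.apply_symm_apply]

/-- The faces opposite `2` and `3` are glued by the inverses of the gluings of the faces opposite
`1` and `0`, so only the latter have to be checked. -/
theorem respects_identified {β : Type*} {f : Fin n × stdSimplex ℝ (Fin 4) → β}
    (h : ∀ (v : Fin 4) (p q : Fin n × stdSimplex ℝ (Fin 4)), v = 0 ∨ v = 1 → p.2.1 v = 0 →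
      q.1 = faceStep s g v p.1 → (∀ w, q.2.1 (facePerm v w) = p.2.1 w) → f p = f q)
    (p q : Fin n × stdSimplex ℝ (Fin 4)) (hpq : (braidGluing s g).Identified p q) : f p = f q := by
  obtain ⟨v, h0, h1, h2⟩ := hpq
  by_cases hv : v = 0 ∨ v = 1
  · exact h v p q hv h0 h1 h2
  · have hv' : ∀ v : Fin 4, ¬ (v = 0 ∨ v = 1) → facePerm v v = 0 ∨ facePerm v v = 1 := by decide
    obtain ⟨h0', h1', h2'⟩ := identified_symm h0 h1 h2
    exact (h _ q p (hv' v hv) h0' h1' h2').symm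

/-- Reindexing a sum over the corners of a tetrahedron along the gluing of the face opposite `v`.
The corner at `v` does not contribute, since a point of that face has no positive depth there. -/
theorem sum_face_compat {M : Type*} [AddCommMonoid M] {c : ℝ} (hc : 0 < c) {v : Fin 4}
    {x y : Fin 4 → ℝ} (hx0 : ∀ l, 0 ≤ x l) (hy0 : ∀ l, 0 ≤ y l) (hx : x v = 0)
    (hy : ∀ w, y (facePerm v w) = x w) {f f' : Fin 4 → ℝ → M}
    (hf : ∀ j, f j 0 = 0) (hf' : ∀ j, f' j 0 = 0)
    (h : ∀ j, j ≠ v → ∀ r, f j r = f' (facePerm v j) r) :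
    ∑ j, f j (max (depth c j x) 0) = ∑ j, f' j (max (depth c j y) 0) := by
  rw [← Equiv.sum_comp (facePerm v) (fun j => f' j (max (depth c j y) 0))]
  refine Finset.sum_congr rfl fun j _ => ?_
  by_cases hj : j = v
  · subst hj
    have h1 := depth_le hc j hx0
    have h2 := depth_le hc (facePerm j j) hy0
    rw [hy] at h2
    rw [max_eq_right (by linarith), max_eq_right (by linarith), hf, hf']
  · rw [depth_facePerm c hj hx hy, h j hj]

theorem totalDepth_respects (hsg : ∀ t, g (s (g t)) = s (s t)) {κ : ℝ} {c : ℝ} (hc : 0 < c)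
    {ω : Fin n → ℂ} (hω : ∀ t, ω (g t) = Complex.exp (κ * Complex.I) * ω t)
    (p q : Fin n × stdSimplex ℝ (Fin 4)) (hpq : (braidGluing s g).Identified p q) :
    totalDepth c s ω p = totalDepth c s ω q := by
  refine respects_identified (f := totalDepth c s ω) (fun v p q hv h0 h1 h2 => ?_) p q hpq
  refine sum_face_compat hc p.2.2.1 q.2.2.1 h0 h2
    (f := fun j r => ‖ω ((s ^ (j : ℕ)) p.1)‖ * r) (f' := fun j r => ‖ω ((s ^ (j : ℕ)) q.1)‖ * r)
    (by simp) (by simp) fun j hj r => ?_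
  rw [h1, (corner_compat hsg κ hω hv hj p.1 h0 h2).1]

theorem totalMap_respects (hsg : ∀ t, g (s (g t)) = s (s t)) {κ : ℝ} {c : ℝ} (hc : 0 < c)
    {ω : Fin n → ℂ} (hω : ∀ t, ω (g t) = Complex.exp (κ * Complex.I) * ω t)
    (p q : Fin n × stdSimplex ℝ (Fin 4)) (hpq : (braidGluing s g).Identified p q) :
    totalMap κ c s ω p = totalMap κ c s ω q := by
  refine respects_identified (f := totalMap κ c s ω) (fun v p q hv h0 h1 h2 => ?_) p q hpq
  refine sum_face_compat hc p.2.2.1 q.2.2.1 h0 h2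
    (f := fun j r => (‖ω ((s ^ (j : ℕ)) p.1)‖ * r) • cornerMap κ (ω ((s ^ (j : ℕ)) p.1)) j p.2.1)
    (f' := fun j r => (‖ω ((s ^ (j : ℕ)) q.1)‖ * r) • cornerMap κ (ω ((s ^ (j : ℕ)) q.1)) j q.2.1)
    (by simp) (by simp) fun j hj r => ?_
  obtain ⟨e1, e2⟩ := corner_compat hsg κ hω hv hj p.1 h0 h2
  simp only [h1]
  rw [e1]
  exact congrArg _ e2.symm

theorem continuous_totalDepth (c : ℝ) (s : Equiv.Perm (Fin n)) (ω : Fin n → ℂ) :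
    Continuous (totalDepth c s ω) := by
  rw [continuous_prod_of_discrete_left]
  intro t
  unfold totalDepth
  refine continuous_finsetSum _ fun j _ => ?_
  have h1 := (continuous_depth c j).comp (continuous_subtype_val (p := (· ∈ stdSimplex ℝ (Fin 4))))
  simp only [Function.comp_def] at h1
  fun_prop

theorem continuous_totalMap (κ c : ℝ) (s : Equiv.Perm (Fin n)) (ω : Fin n → ℂ) :
    Continuous (totalMap κ c s ω) := by
  rw [continuous_prod_of_discrete_left]
  intro t
  unfold totalMap
  refine continuous_finsetSum _ fun j _ => ?_
  have h1 := (continuous_depth c j).comp (continuous_subtype_val (p := (· ∈ stdSimplex ℝ (Fin 4))))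
  have h2 := (continuous_cornerMap κ (ω ((s ^ (j : ℕ)) t)) j).comp
    (continuous_subtype_val (p := (· ∈ stdSimplex ℝ (Fin 4))))
  simp only [Function.comp_def] at h1 h2
  have h3 : Continuous fun x : stdSimplex ℝ (Fin 4) =>
      ‖ω ((s ^ (j : ℕ)) t)‖ * max (depth c j x.1) 0 := by fun_prop
  exact h3.smul h2

end

section
variable {n : ℕ} {s g : Equiv.Perm (Fin n)}

/-! ### Coordinates in the corners around a vertex -/

/-- The point `p` of the realization lies in the corner at `j` of the tetrahedron `t` with
`s ^ j t = g ^ i t₀`, and its coordinates there, divided by the depth, are `b`; the coordinate `b j`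
carries no information and is set to `0`.  These corners, for `0 ≤ j < 4` and `i` modulo the period
of `t₀`, are the corners at one vertex. -/
def HasCoords (c : ℝ) (s g : Equiv.Perm (Fin n)) (t₀ : Fin n) (p : (braidGluing s g).Realization)
    (j : Fin 4) (i : ℤ) (b : Fin 4 → ℝ) : Prop :=
  ∃ (t : Fin n) (x : stdSimplex ℝ (Fin 4)), p = Quot.mk _ (t, x) ∧ (s ^ (j : ℕ)) t = (g ^ i) t₀ ∧
    0 < depth c j x.1 ∧ b j = 0 ∧ ∀ l, l ≠ j → x.1 l = depth c j x.1 * b l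

variable {c : ℝ} {t₀ : Fin n} {p q : (braidGluing s g).Realization} {i i' : ℤ}

theorem HasCoords.nonneg {j : Fin 4} {b : Fin 4 → ℝ} (h : HasCoords c s g t₀ p j i b) (l : Fin 4) :
    0 ≤ b l := by
  obtain ⟨t, x, -, -, hd, hj, hb⟩ := h
  by_cases hl : l = j
  · rw [hl, hj]
  · have h1 := x.2.1 l
    rw [hb l hl] at h1
    exact nonneg_of_mul_nonneg_right h1 hd

theorem HasCoords.eq_zero {j : Fin 4} {b : Fin 4 → ℝ} (h : HasCoords c s g t₀ p j i b) :
    b j = 0 := by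
  obtain ⟨t, x, -, -, hd, hj, hb⟩ := h
  exact hj

/-- The depth is determined by the coordinates divided by the depth. -/
theorem depth_eq_of_coords {j : Fin 4} {b x : Fin 4 → ℝ} (hx : x ∈ stdSimplex ℝ (Fin 4))
    (hj : b j = 0)
    (hb : ∀ l, l ≠ j → x l = depth c j x * b l) :
    depth c j x * (1 + ∑ l, (1 + cornerWeight c j l) * b l) = 1 := by
  have h1 : ∀ l, x l = (if l = j then x j else 0) + depth c j x * b l := by
    intro l
    by_cases hl : l = j
    · rw [hl, hj]; simp
    · rw [if_neg hl, zero_add, ← hb l hl]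
  have h2 : ∑ l, x l = x j + depth c j x * ∑ l, b l := by
    rw [Finset.sum_congr rfl fun l _ => h1 l, Finset.sum_add_distrib, ← Finset.mul_sum]
    simp
  have h3 : ∑ l, cornerWeight c j l * x l = depth c j x * ∑ l, cornerWeight c j l * b l := by
    rw [Finset.mul_sum]
    refine Finset.sum_congr rfl fun l _ => ?_
    by_cases hl : l = j
    · simp [hl, cornerWeight]
    · rw [hb l hl]; ring
  have h4 : depth c j x = x j - ∑ l, cornerWeight c j l * x l := rfl
  rw [hx.2] at h2
  rw [h3] at h4
  simp only [add_mul, one_mul, Finset.sum_add_distrib]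
  linarith

theorem HasCoords.unique {j : Fin 4} {b : Fin 4 → ℝ} (hp : HasCoords c s g t₀ p j i b)
    (hq : HasCoords c s g t₀ q j i b) : p = q := by
  obtain ⟨t, x, rfl, ht, hd, hj, hb⟩ := hp
  obtain ⟨t', x', rfl, ht', hd', -, hb'⟩ := hq
  have e1 : t = t' := (s ^ (j : ℕ)).injective (ht.trans ht'.symm)
  have e2 : depth c j x.1 = depth c j x'.1 := by
    have h1 := depth_eq_of_coords x.2 hj hb
    have h2 := depth_eq_of_coords x'.2 hj hb'
    rw [eq_one_div_of_mul_eq_one_left h1, eq_one_div_of_mul_eq_one_left h2]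
  have e3 : x = x' := by
    refine Subtype.ext (funext fun l => ?_)
    by_cases hl : l = j
    · have h1 := x.2.2
      have h2 := x'.2.2
      rw [← Finset.add_sum_erase _ _ (Finset.mem_univ j)] at h1 h2
      have h3 : ∑ l ∈ Finset.univ.erase j, x.1 l = ∑ l ∈ Finset.univ.erase j, x'.1 l :=
        Finset.sum_congr rfl fun l hl => by
          rw [hb l (Finset.ne_of_mem_erase hl), hb' l (Finset.ne_of_mem_erase hl), e2]
      rw [hl]; linarith
    · rw [hb l hl, hb' l hl, e2]
  rw [e1, e3]

theorem exists_hasCoords (hc : 0 < c) (j : Fin 4) (i : ℤ) {b : Fin 4 → ℝ} (hb : ∀ l, 0 ≤ b l)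
    (hj : b j = 0) : ∃ p, HasCoords c s g t₀ p j i b := by
  set W := ∑ l, cornerWeight c j l * b l with hW
  have hW0 : 0 ≤ W := sum_cornerWeight_nonneg hc j hb
  -- the point with depth `1` before the coordinates are normalized to have sum `1`
  set y : Fin 4 → ℝ := fun l => b l + if l = j then 1 + W else 0 with hy
  have hsum : ∑ l, y l = 1 + W + ∑ l, b l := by
    rw [hy, Finset.sum_add_distrib]; simp; ring
  have hb0 : 0 ≤ ∑ l, b l := Finset.sum_nonneg fun l _ => hb l
  set D := 1 + W + ∑ l, b l with hD
  have hDpos : 0 < D := by positivity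
  have hx : (fun l => y l / D) ∈ stdSimplex ℝ (Fin 4) := by
    refine ⟨fun l => div_nonneg ?_ hDpos.le, ?_⟩
    · have := hb l
      simp only [hy]; split_ifs <;> linarith
    · rw [← Finset.sum_div, hsum, div_self hDpos.ne']
  have hd : depth c j (fun l => y l / D) = 1 / D := by
    have h1 : ∑ l, cornerWeight c j l * (y l / D) = W / D := by
      rw [hW, Finset.sum_div]
      refine Finset.sum_congr rfl fun l _ => ?_
      by_cases hl : l = j
      · simp [hl, cornerWeight]
      · simp [hy, hl, mul_div_assoc]
    rw [depth, h1, hy]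
    simp only [hj, if_true, zero_add]
    rw [← sub_div]; congr 1; ring
  refine ⟨Quot.mk _ ((s ^ (j : ℕ)).symm ((g ^ i) t₀), ⟨_, hx⟩), _, _, rfl,
    Equiv.apply_symm_apply _ _, ?_, hj, fun l hl => ?_⟩
  · simp only [hd]; positivity
  · change y l / D = depth c j (fun l => y l / D) * b l
    rw [hd]
    simp only [hy, if_neg hl]
    ring

/-- Coordinates in the adjacent corner of a point on the face opposite `v`. -/
theorem HasCoords.glue {j v : Fin 4} {b : Fin 4 → ℝ} (h : HasCoords c s g t₀ p j i b)
    (hj : j ≠ v) (hv : b v = 0)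
    (ht : ∀ t, (s ^ (j : ℕ)) t = (g ^ i) t₀ →
      (s ^ (facePerm v j : ℕ)) (faceStep s g v t) = (g ^ i') t₀) :
    HasCoords c s g t₀ p (facePerm v j) i' (b ∘ (facePerm v).symm) := by
  obtain ⟨t, x, rfl, h1, hd, hj0, hb⟩ := h
  have hxv : x.1 v = 0 := by rw [hb v hj.symm, hv, mul_zero]
  have hy : x.1 ∘ (facePerm v).symm ∈ stdSimplex ℝ (Fin 4) :=
    ⟨fun l => x.2.1 _, by rw [← x.2.2]; exact Equiv.sum_comp (facePerm v).symm x.1⟩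
  have hd' : depth c (facePerm v j) (x.1 ∘ (facePerm v).symm) = depth c j x.1 :=
    depth_facePerm c hj hxv fun w => by simp
  refine ⟨faceStep s g v t, ⟨_, hy⟩, Quot.sound ⟨v, hxv, rfl, fun w => ?_⟩, ht t h1, ?_,
    by simpa, ?_⟩
  · simp [braidGluing]
  · simpa only [hd'] using hd
  · intro l hl
    simp only [hd', Function.comp_apply]
    exact hb _ fun h => hl (by rw [← h, Equiv.apply_symm_apply])

theorem comp_facePerm_zero (b0 b1 b2 b3 : ℝ) :
    ![b0, b1, b2, b3] ∘ (facePerm 0).symm = ![b1, b2, b3, b0] := by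
  funext l
  obtain ⟨w, rfl⟩ := (facePerm 0).surjective l
  rw [Function.comp_apply, Equiv.symm_apply_apply]
  fin_cases w <;> rfl

theorem comp_facePerm_one (b0 b1 b2 b3 : ℝ) :
    ![b0, b1, b2, b3] ∘ (facePerm 1).symm = ![b0, b2, b1, b3] := by
  funext l
  fin_cases l <;> rfl

theorem HasCoords.succ_top {b2 b3 : ℝ} (h : HasCoords c s g t₀ p 0 i ![0, 0, b2, b3]) :
    HasCoords c s g t₀ p 0 (i + 1) ![0, b2, 0, b3] := by
  rw [← comp_facePerm_one 0 0 b2 b3]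
  refine h.glue (v := 1) (by decide) rfl fun t ht => ?_
  change g t = _
  rw [show t = (g ^ i) t₀ from ht, add_comm, zpow_add]; rfl

theorem HasCoords.succ_bottom (hsg : ∀ t, g (s (g t)) = s (s t)) {b0 b2 : ℝ}
    (h : HasCoords c s g t₀ p 3 i ![b0, 0, b2, 0]) :
    HasCoords c s g t₀ p 3 (i + 1) ![b0, b2, 0, 0] := by
  rw [← comp_facePerm_one b0 0 b2 0]
  refine h.glue (v := 1) (by decide) rfl fun t ht => ?_
  change s (s (s (g t))) = _
  rw [pow_three_comm hsg, show s (s (s t)) = (g ^ i) t₀ from ht, add_comm, zpow_add]; rfl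

theorem HasCoords.one_zero {b2 b3 : ℝ} (h : HasCoords c s g t₀ p 1 i ![0, 0, b2, b3]) :
    HasCoords c s g t₀ p 0 i ![0, b2, b3, 0] := by
  rw [← comp_facePerm_zero 0 0 b2 b3]
  exact h.glue (v := 0) (by decide) rfl fun t ht => ht

theorem HasCoords.two_one {b1 b3 : ℝ} (h : HasCoords c s g t₀ p 2 i ![0, b1, 0, b3]) :
    HasCoords c s g t₀ p 1 i ![b1, 0, b3, 0] := by
  rw [← comp_facePerm_zero 0 b1 0 b3]
  exact h.glue (v := 0) (by decide) rfl fun t ht => ht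

theorem HasCoords.three_two {b1 b2 : ℝ} (h : HasCoords c s g t₀ p 3 i ![0, b1, b2, 0]) :
    HasCoords c s g t₀ p 2 i ![b1, b2, 0, 0] := by
  rw [← comp_facePerm_zero 0 b1 b2 0]
  exact h.glue (v := 0) (by decide) rfl fun t ht => ht

theorem HasCoords.two_one_succ (hsg : ∀ t, g (s (g t)) = s (s t)) {b0 b3 : ℝ}
    (h : HasCoords c s g t₀ p 2 i ![b0, 0, 0, b3]) :
    HasCoords c s g t₀ p 1 (i - 1) ![b0, 0, 0, b3] := by
  rw [← comp_facePerm_one b0 0 0 b3]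
  refine h.glue (v := 1) (by decide) rfl fun t ht => ?_
  change s (g t) = _
  apply g.injective
  rw [hsg, show s (s t) = (g ^ i) t₀ from ht, ← Equiv.Perm.mul_apply, ← zpow_one_add]
  congr 2; ring

theorem comp_facePerm_three (b0 b1 b2 b3 : ℝ) :
    ![b0, b1, b2, b3] ∘ (facePerm 3).symm = ![b3, b0, b1, b2] := by
  funext l
  obtain ⟨w, rfl⟩ := (facePerm 3).surjective l
  rw [Function.comp_apply, Equiv.symm_apply_apply]
  fin_cases w <;> rfl

theorem HasCoords.two_three {b0 b1 : ℝ} (h : HasCoords c s g t₀ p 2 i ![b0, b1, 0, 0]) :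
    HasCoords c s g t₀ p 3 i ![0, b0, b1, 0] := by
  rw [← comp_facePerm_three b0 b1 0 0]
  refine h.glue (v := 3) (by decide) rfl fun t ht => ?_
  change s (s (s (s⁻¹ t))) = _
  rw [← ht]
  simp [pow_two]

theorem HasCoords.one_two {b0 b2 : ℝ} (h : HasCoords c s g t₀ p 1 i ![b0, 0, b2, 0]) :
    HasCoords c s g t₀ p 2 i ![0, b0, 0, b2] := by
  rw [← comp_facePerm_three b0 0 b2 0]
  refine h.glue (v := 3) (by decide) rfl fun t ht => ?_
  change s (s (s⁻¹ t)) = _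
  rw [← ht]
  simp

theorem HasCoords.zero_one {b1 b2 : ℝ} (h : HasCoords c s g t₀ p 0 i ![0, b1, b2, 0]) :
    HasCoords c s g t₀ p 1 i ![0, 0, b1, b2] := by
  rw [← comp_facePerm_three 0 b1 b2 0]
  refine h.glue (v := 3) (by decide) rfl fun t ht => ?_
  change s (s⁻¹ t) = _
  rw [← ht]
  simp

end

section
variable {n : ℕ} {s g : Equiv.Perm (Fin n)}

/-! ### Cylindrical coordinates are a bijection -/

variable {c : ℝ} {t₀ : Fin n} {p q : (braidGluing s g).Realization} {i i' : ℤ}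

/-- The point `p` has radius `r`, arc length `μ` and height `z` around the vertex.  The arc length
is unwrapped to the real line, so that a point has many triples of coordinates. -/
def HasCylCoords (c : ℝ) (s g : Equiv.Perm (Fin n)) (t₀ : Fin n) (p : (braidGluing s g).Realization)
    (r μ z : ℝ) : Prop :=
  ∃ j i b, HasCoords c s g t₀ p j i b ∧ cornerRadius j b = r ∧ i * r + cornerTwist j b = μ ∧
    cornerHeight j b = z

theorem HasCoords.exists_zero {b : Fin 4 → ℝ} (h : HasCoords c s g t₀ p 0 i b) :
    ∃ b1 b2 b3, b = ![0, b1, b2, b3] ∧ 0 ≤ b1 ∧ 0 ≤ b2 ∧ 0 ≤ b3 :=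
  ⟨b 1, b 2, b 3, by funext l; fin_cases l <;> simp [h.eq_zero], h.nonneg 1, h.nonneg 2, h.nonneg 3⟩

theorem HasCoords.exists_one {b : Fin 4 → ℝ} (h : HasCoords c s g t₀ p 1 i b) :
    ∃ b0 b2 b3, b = ![b0, 0, b2, b3] ∧ 0 ≤ b0 ∧ 0 ≤ b2 ∧ 0 ≤ b3 :=
  ⟨b 0, b 2, b 3, by funext l; fin_cases l <;> simp [h.eq_zero], h.nonneg 0, h.nonneg 2, h.nonneg 3⟩

theorem HasCoords.exists_two {b : Fin 4 → ℝ} (h : HasCoords c s g t₀ p 2 i b) :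
    ∃ b0 b1 b3, b = ![b0, b1, 0, b3] ∧ 0 ≤ b0 ∧ 0 ≤ b1 ∧ 0 ≤ b3 :=
  ⟨b 0, b 1, b 3, by funext l; fin_cases l <;> simp [h.eq_zero], h.nonneg 0, h.nonneg 1, h.nonneg 3⟩

theorem HasCoords.exists_three {b : Fin 4 → ℝ} (h : HasCoords c s g t₀ p 3 i b) :
    ∃ b0 b1 b2, b = ![b0, b1, b2, 0] ∧ 0 ≤ b0 ∧ 0 ≤ b1 ∧ 0 ≤ b2 :=
  ⟨b 0, b 1, b 2, by funext l; fin_cases l <;> simp [h.eq_zero], h.nonneg 0, h.nonneg 1, h.nonneg 2⟩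

/-- In the upper cone `r ≤ z` every point has coordinates in a corner `0`: a corner of another type
meets this cone in its boundary only, and one passes to the corner `0` through faces. -/
theorem HasCylCoords.top {r μ z : ℝ} (h : HasCylCoords c s g t₀ p r μ z) (hz : r ≤ z) :
    ∃ (i : ℤ) (b1 b2 b3 : ℝ), HasCoords c s g t₀ p 0 i ![0, b1, b2, b3] ∧ 0 ≤ b1 ∧ 0 ≤ b2 ∧
      b1 + b2 = r ∧ i * r + b2 = μ ∧ b1 + b2 + b3 = z := by
  obtain ⟨j, i, b, h, hr, hμ, hz'⟩ := h
  fin_cases j <;> dsimp only [Fin.zero_eta, Fin.mk_one, Fin.reduceFinMk] at h hr hμ hz'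
  · obtain ⟨b1, b2, b3, rfl, h1, h2, h3⟩ := h.exists_zero
    simp [cornerRadius, cornerTwist, cornerHeight] at hr hμ hz'
    exact ⟨i, b1, b2, b3, h, h1, h2, hr, hμ, hz'⟩
  · obtain ⟨b0, b2, b3, rfl, h0, h2, h3⟩ := h.exists_one
    simp [cornerRadius, cornerTwist, cornerHeight] at hr hμ hz'
    obtain rfl : b0 = 0 := by linarith
    exact ⟨i, b2, b3, 0, h.one_zero, h2, h3, by linarith, by linarith, by linarith⟩
  · obtain ⟨b0, b1, b3, rfl, h0, h1, h3⟩ := h.exists_two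
    simp [cornerRadius, cornerTwist, cornerHeight] at hr hμ hz'
    obtain rfl : b0 = 0 := by linarith
    obtain rfl : b1 = 0 := by linarith
    exact ⟨i, b3, 0, 0, h.two_one.one_zero, h3, le_rfl, by linarith, by linarith, by linarith⟩
  · obtain ⟨b0, b1, b2, rfl, h0, h1, h2⟩ := h.exists_three
    simp [cornerRadius, cornerTwist, cornerHeight] at hr hμ hz'
    obtain rfl : b0 = 0 := by linarith
    obtain rfl : b1 = 0 := by linarith
    obtain rfl : b2 = 0 := by linarith
    exact ⟨i, 0, 0, 0, h.three_two.two_one.one_zero, le_rfl, le_rfl, by linarith, by linarith,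
      by linarith⟩

/-- In the lower cone `z ≤ -r` every point has coordinates in a corner `3`. -/
theorem HasCylCoords.bottom {r μ z : ℝ} (h : HasCylCoords c s g t₀ p r μ z) (hz : z ≤ -r) :
    ∃ (i : ℤ) (b0 b1 b2 : ℝ), HasCoords c s g t₀ p 3 i ![b0, b1, b2, 0] ∧ 0 ≤ b1 ∧ 0 ≤ b2 ∧
      b1 + b2 = r ∧ i * r + (b2 - b1) / 2 = μ ∧ -(b0 + b1 + b2) = z := by
  obtain ⟨j, i, b, h, hr, hμ, hz'⟩ := h
  fin_cases j <;> dsimp only [Fin.zero_eta, Fin.mk_one, Fin.reduceFinMk] at h hr hμ hz'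
  · obtain ⟨b1, b2, b3, rfl, h1, h2, h3⟩ := h.exists_zero
    simp [cornerRadius, cornerTwist, cornerHeight] at hr hμ hz'
    obtain rfl : b1 = 0 := by linarith
    obtain rfl : b2 = 0 := by linarith
    obtain rfl : b3 = 0 := by linarith
    refine ⟨i, 0, 0, 0, ?_, le_rfl, le_rfl, by linarith, by linarith, by linarith⟩
    exact h.zero_one.one_two.two_three
  · obtain ⟨b0, b2, b3, rfl, h0, h2, h3⟩ := h.exists_one
    simp [cornerRadius, cornerTwist, cornerHeight] at hr hμ hz'
    obtain rfl : b2 = 0 := by linarith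
    obtain rfl : b3 = 0 := by linarith
    exact ⟨i, 0, 0, b0, h.one_two.two_three, le_rfl, h0, by linarith, by linarith, by linarith⟩
  · obtain ⟨b0, b1, b3, rfl, h0, h1, h3⟩ := h.exists_two
    simp [cornerRadius, cornerTwist, cornerHeight] at hr hμ hz'
    obtain rfl : b3 = 0 := by linarith
    exact ⟨i, 0, b0, b1, h.two_three, h0, h1, by linarith, by linarith, by linarith⟩
  · obtain ⟨b0, b1, b2, rfl, h0, h1, h2⟩ := h.exists_three
    simp [cornerRadius, cornerTwist, cornerHeight] at hr hμ hz'
    exact ⟨i, b0, b1, b2, h, h1, h2, hr, hμ, by linarith⟩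

theorem HasCoords.add_top {b3 : ℝ} (h : HasCoords c s g t₀ p 0 i ![0, 0, 0, b3]) (m : ℕ) :
    HasCoords c s g t₀ p 0 (i + m) ![0, 0, 0, b3] := by
  induction m with
  | zero => simpa using h
  | succ m ih => rw [Nat.cast_succ, ← add_assoc]; exact ih.succ_top

theorem HasCoords.add_bottom (hsg : ∀ t, g (s (g t)) = s (s t)) {b0 : ℝ}
    (h : HasCoords c s g t₀ p 3 i ![b0, 0, 0, 0]) (m : ℕ) :
    HasCoords c s g t₀ p 3 (i + m) ![b0, 0, 0, 0] := by
  induction m with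
  | zero => simpa using h
  | succ m ih => rw [Nat.cast_succ, ← add_assoc]; exact ih.succ_bottom hsg

/-- Points at the offsets `m` and `m'` from the multiples `i * r ≤ i' * r`, on arcs of length at
most `r`, only coincide on the same arc, or at the end of one arc and the start of the next. -/
theorem index_cases {i i' : ℤ} {r m m' : ℝ} (hr : 0 < r) (hm : m - m' ≤ r)
    (h : i * r + m = i' * r + m')
    (hi : i ≤ i') : i' = i ∧ m = m' ∨ i' = i + 1 ∧ m = m' + r := by
  have h1 : ((i' - i : ℤ) : ℝ) * r ≤ 1 * r := by push_cast; linarith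
  have h2 : ((i' - i : ℤ) : ℝ) ≤ 1 := le_of_mul_le_mul_right h1 hr
  have h3 : i' - i ≤ 1 := by exact_mod_cast h2
  obtain h4 | h4 : i' = i ∨ i' = i + 1 := by omega
  · subst h4; exact Or.inl ⟨rfl, by linarith⟩
  · subst h4
    push_cast at h
    exact Or.inr ⟨rfl, by linarith⟩

theorem HasCoords.eq_top (hi : i ≤ i') {b1 b2 b3 b1' b2' : ℝ}
    (h : HasCoords c s g t₀ p 0 i ![0, b1, b2, b3])
    (h' : HasCoords c s g t₀ q 0 i' ![0, b1', b2', b3])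
    (h1 : 0 ≤ b1) (h2 : 0 ≤ b2) (h1' : 0 ≤ b1') (h2' : 0 ≤ b2') (hr : b1 + b2 = b1' + b2')
    (hμ : i * (b1 + b2) + b2 = i' * (b1 + b2) + b2') : p = q := by
  rcases (add_nonneg h1 h2).eq_or_lt' with h0 | h0
  · obtain rfl : b1 = 0 := by linarith
    obtain rfl : b2 = 0 := by linarith
    obtain rfl : b1' = 0 := by linarith
    obtain rfl : b2' = 0 := by linarith
    obtain ⟨m, rfl⟩ := Int.le.dest hi
    exact (h.add_top m).unique h'
  · rcases index_cases h0 (by linarith) hμ hi with ⟨rfl, e⟩ | ⟨rfl, e⟩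
    · obtain rfl : b2 = b2' := e
      obtain rfl : b1 = b1' := by linarith
      exact h.unique h'
    · obtain rfl : b1 = 0 := by linarith
      obtain rfl : b2' = 0 := by linarith
      obtain rfl : b2 = b1' := by linarith
      exact h.succ_top.unique h'

theorem HasCoords.eq_bottom (hsg : ∀ t, g (s (g t)) = s (s t)) (hi : i ≤ i') {b0 b1 b2 b1' b2' : ℝ}
    (h : HasCoords c s g t₀ p 3 i ![b0, b1, b2, 0])
    (h' : HasCoords c s g t₀ q 3 i' ![b0, b1', b2', 0])
    (h1 : 0 ≤ b1) (h2 : 0 ≤ b2) (h1' : 0 ≤ b1') (h2' : 0 ≤ b2') (hr : b1 + b2 = b1' + b2')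
    (hμ : i * (b1 + b2) + (b2 - b1) / 2 = i' * (b1 + b2) + (b2' - b1') / 2) : p = q := by
  rcases (add_nonneg h1 h2).eq_or_lt' with h0 | h0
  · obtain rfl : b1 = 0 := by linarith
    obtain rfl : b2 = 0 := by linarith
    obtain rfl : b1' = 0 := by linarith
    obtain rfl : b2' = 0 := by linarith
    obtain ⟨m, rfl⟩ := Int.le.dest hi
    exact (h.add_bottom hsg m).unique h'
  · rcases index_cases h0 (by linarith) hμ hi with ⟨rfl, e⟩ | ⟨rfl, e⟩
    · obtain rfl : b2 = b2' := by linarith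
      obtain rfl : b1 = b1' := by linarith
      exact h.unique h'
    · obtain rfl : b1 = 0 := by linarith
      obtain rfl : b2' = 0 := by linarith
      obtain rfl : b2 = b1' := by linarith
      exact (h.succ_bottom hsg).unique h'

/-- Between the two cones every point has coordinates in a corner `1` or `2`. -/
theorem HasCylCoords.band {r μ z : ℝ} (h : HasCylCoords c s g t₀ p r μ z) (hz : z < r)
    (hz' : -r < z) :
    (∃ (i : ℤ) (b2 b3 : ℝ), HasCoords c s g t₀ p 1 i ![(r - z) / 2, 0, b2, b3] ∧ 0 ≤ b2 ∧ 0 ≤ b3 ∧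
      b2 + b3 = (r + z) / 2 ∧ i * r + (b3 + (r - z) / 4) = μ) ∨
    (∃ (i : ℤ) (b0 b1 : ℝ), HasCoords c s g t₀ p 2 i ![b0, b1, 0, (r + z) / 2] ∧ 0 ≤ b0 ∧ 0 ≤ b1 ∧
      b0 + b1 = (r - z) / 2 ∧ i * r + (b1 - b0) / 2 = μ) := by
  obtain ⟨j, i, b, h, hr, hμ, hz'⟩ := h
  fin_cases j <;> dsimp only [Fin.zero_eta, Fin.mk_one, Fin.reduceFinMk] at h hr hμ hz'
  · obtain ⟨b1, b2, b3, rfl, h1, h2, h3⟩ := h.exists_zero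
    simp [cornerRadius, cornerTwist, cornerHeight] at hr hμ hz'
    linarith
  · obtain ⟨b0, b2, b3, rfl, h0, h2, h3⟩ := h.exists_one
    simp [cornerRadius, cornerTwist, cornerHeight] at hr hμ hz'
    obtain rfl : b0 = (r - z) / 2 := by linarith
    exact Or.inl ⟨i, b2, b3, h, h2, h3, by linarith, by linarith⟩
  · obtain ⟨b0, b1, b3, rfl, h0, h1, h3⟩ := h.exists_two
    simp [cornerRadius, cornerTwist, cornerHeight] at hr hμ hz'
    obtain rfl : b3 = (r + z) / 2 := by linarith
    exact Or.inr ⟨i, b0, b1, h, h0, h1, by linarith, by linarith⟩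
  · obtain ⟨b0, b1, b2, rfl, h0, h1, h2⟩ := h.exists_three
    simp [cornerRadius, cornerTwist, cornerHeight] at hr hμ hz'
    linarith

/-- Between the two cones a corner `1` and a corner `2` only meet in a common face. -/
theorem HasCoords.eq_one_two (hsg : ∀ t, g (s (g t)) = s (s t)) {r z b0 b1 b2 b3 : ℝ}
    (h : HasCoords c s g t₀ p 1 i ![(r - z) / 2, 0, b2, b3])
    (h' : HasCoords c s g t₀ q 2 i' ![b0, b1, 0, (r + z) / 2]) (hz : z < r) (hz' : -r < z)
    (h2 : 0 ≤ b2) (h3 : 0 ≤ b3) (h0 : 0 ≤ b0) (h1 : 0 ≤ b1) (hα : b2 + b3 = (r + z) / 2)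
    (hγ : b0 + b1 = (r - z) / 2)
    (hμ : i * r + (b3 + (r - z) / 4) = i' * r + (b1 - b0) / 2) : p = q := by
  have hr : 0 < r := by linarith
  rcases le_total i i' with hi | hi
  · rcases index_cases hr (by linarith) hμ hi with ⟨rfl, e⟩ | ⟨rfl, e⟩
    · obtain rfl : b3 = 0 := by linarith
      obtain rfl : b0 = 0 := by linarith
      obtain rfl : b2 = (r + z) / 2 := by linarith
      obtain rfl : b1 = (r - z) / 2 := by linarith
      exact h.one_two.unique h'
    · obtain rfl : b2 = 0 := by linarith
      obtain rfl : b1 = 0 := by linarith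
      obtain rfl : b3 = (r + z) / 2 := by linarith
      obtain rfl : b0 = (r - z) / 2 := by linarith
      have h'' := h'.two_one_succ hsg
      rw [add_sub_cancel_right] at h''
      exact h.unique h''
  · rcases index_cases hr (by linarith) hμ.symm hi with ⟨rfl, e⟩ | ⟨rfl, e⟩
    · obtain rfl : b3 = 0 := by linarith
      obtain rfl : b0 = 0 := by linarith
      obtain rfl : b2 = (r + z) / 2 := by linarith
      obtain rfl : b1 = (r - z) / 2 := by linarith
      exact h.one_two.unique h'
    · linarith

/-- The cylindrical coordinates determine the point. -/
theorem HasCylCoords.unique (hsg : ∀ t, g (s (g t)) = s (s t)) {r μ z : ℝ}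
    (hp : HasCylCoords c s g t₀ p r μ z) (hq : HasCylCoords c s g t₀ q r μ z) : p = q := by
  rcases le_or_gt r z with hz | hz
  · obtain ⟨i, b1, b2, b3, h, h1, h2, rfl, rfl, h3⟩ := hp.top hz
    obtain ⟨i', b1', b2', b3', h', h1', h2', hr, hμ, h3'⟩ := hq.top hz
    obtain rfl : b3 = b3' := by linarith
    rcases le_total i i' with hi | hi
    · exact h.eq_top hi h' h1 h2 h1' h2' hr.symm hμ.symm
    · exact (h'.eq_top hi h h1' h2' h1 h2 hr (by rw [hr]; exact hμ)).symm
  rcases le_or_gt z (-r) with hz' | hz'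
  · obtain ⟨i, b0, b1, b2, h, h1, h2, rfl, rfl, h3⟩ := hp.bottom hz'
    obtain ⟨i', b0', b1', b2', h', h1', h2', hr, hμ, h3'⟩ := hq.bottom hz'
    obtain rfl : b0 = b0' := by linarith
    rcases le_total i i' with hi | hi
    · exact h.eq_bottom hsg hi h' h1 h2 h1' h2' hr.symm hμ.symm
    · exact (h'.eq_bottom hsg hi h h1' h2' h1 h2 hr (by rw [hr]; exact hμ)).symm
  have hr : 0 < r := by linarith
  rcases hp.band hz hz' with ⟨i, b2, b3, h, h2, h3, hα, rfl⟩ | ⟨i, b0, b1, h, h0, h1, hγ, rfl⟩ <;>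
  rcases hq.band hz hz' with ⟨i', b2', b3', h', h2', h3', hα', hμ⟩ |
    ⟨i', b0', b1', h', h0', h1', hγ', hμ⟩
  · rcases le_total i i' with hi | hi
    · rcases index_cases hr (by linarith) hμ.symm hi with ⟨rfl, e⟩ | ⟨rfl, e⟩
      · obtain rfl : b3 = b3' := by linarith
        obtain rfl : b2 = b2' := by linarith
        exact h.unique h'
      · linarith
    · rcases index_cases hr (by linarith) hμ hi with ⟨rfl, e⟩ | ⟨rfl, e⟩
      · obtain rfl : b3 = b3' := by linarith
        obtain rfl : b2 = b2' := by linarith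
        exact h.unique h'
      · linarith
  · exact h.eq_one_two hsg h' hz hz' h2 h3 h0' h1' hα hγ' hμ.symm
  · exact (h'.eq_one_two hsg h hz hz' h2' h3' h0 h1 hα' hγ hμ).symm
  · rcases le_total i i' with hi | hi
    · rcases index_cases hr (by linarith) hμ.symm hi with ⟨rfl, e⟩ | ⟨rfl, e⟩
      · obtain rfl : b0 = b0' := by linarith
        obtain rfl : b1 = b1' := by linarith
        exact h.unique h'
      · linarith
    · rcases index_cases hr (by linarith) hμ hi with ⟨rfl, e⟩ | ⟨rfl, e⟩
      · obtain rfl : b0 = b0' := by linarith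
        obtain rfl : b1 = b1' := by linarith
        exact h.unique h'
      · linarith

/-- All cylindrical coordinates occur. -/
theorem exists_hasCylCoords (hc : 0 < c) {r z : ℝ} (μ : ℝ) (hr : 0 ≤ r) (hμ : r = 0 → μ = 0) :
    ∃ p : (braidGluing s g).Realization, HasCylCoords c s g t₀ p r μ z := by
  -- a multiple `i * r` just below `μ + a`; for `r = 0` any `i` will do
  have hfl : ∀ a : ℝ, (r = 0 → a = 0) → ∃ i : ℤ, 0 ≤ μ + a - i * r ∧ μ + a - i * r ≤ r := by
    intro a ha
    rcases hr.eq_or_lt' with h | h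
    · exact ⟨0, by simp [h, hμ h, ha h]⟩
    · refine ⟨⌊(μ + a) / r⌋, ?_, ?_⟩
      · have := (le_div_iff₀ h).1 (Int.floor_le ((μ + a) / r))
        linarith
      · have := (div_lt_iff₀ h).1 (Int.lt_floor_add_one ((μ + a) / r))
        linarith
  have mk : ∀ (j : Fin 4) (i : ℤ) (b : Fin 4 → ℝ), (∀ l, 0 ≤ b l) → b j = 0 → cornerRadius j b = r →
      i * r + cornerTwist j b = μ → cornerHeight j b = z →
      ∃ p : (braidGluing s g).Realization, HasCylCoords c s g t₀ p r μ z := by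
    intro j i b h1 h2 h3 h4 h5
    obtain ⟨p, hp⟩ := exists_hasCoords (s := s) (g := g) (t₀ := t₀) hc j i h1 h2
    exact ⟨p, j, i, b, hp, h3, h4, h5⟩
  rcases le_or_gt r z with hz | hz
  · obtain ⟨i, h0, h1⟩ := hfl 0 fun _ => rfl
    refine mk 0 i ![0, r - (μ - i * r), μ - i * r, z - r] ?_ rfl ?_ ?_ ?_
    · intro l; fin_cases l <;> simp <;> linarith
    all_goals simp [cornerRadius, cornerTwist, cornerHeight]
  rcases le_or_gt z (-r) with hz' | hz'
  · obtain ⟨i, h0, h1⟩ := hfl (r / 2) fun h => by rw [h, zero_div]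
    refine mk 3 i ![-z - r, r / 2 - (μ - i * r), r / 2 + (μ - i * r), 0] ?_ rfl ?_ ?_ ?_
    · intro l; fin_cases l <;> simp <;> linarith
    all_goals simp [cornerRadius, cornerTwist, cornerHeight]
    all_goals ring
  -- at height `z` the arcs of the corners `2` have length `(r - z) / 2` and are centred at the
  -- multiples of `r`; those of the corners `1` fill the gaps
  obtain ⟨i, h0, h1⟩ := hfl ((r - z) / 4) fun h => by linarith
  rcases le_or_gt (μ - i * r) ((r - z) / 4) with h | h
  · refine mk 2 i ![(r - z) / 4 - (μ - i * r), (r - z) / 4 + (μ - i * r), 0, (r + z) / 2]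
      ?_ rfl ?_ ?_ ?_
    · intro l; fin_cases l <;> simp <;> linarith
    all_goals simp [cornerRadius, cornerTwist, cornerHeight]
    all_goals ring
  · refine mk 1 i ![(r - z) / 2, 0, (r + z) / 2 - (μ - i * r - (r - z) / 4),
      μ - i * r - (r - z) / 4]
      ?_ rfl ?_ ?_ ?_
    · intro l; fin_cases l <;> simp <;> linarith
    all_goals simp [cornerRadius, cornerTwist, cornerHeight]
    all_goals ring

end

/-! ### Charts -/

/-- A continuous bijection from the open set where `D` is positive onto `E` is a homeomorphism if
`D` is bounded below on the preimages of bounded sets: it is then proper, hence closed. -/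
theorem nonempty_homeomorph_of_proper {X E : Type*} [TopologicalSpace X] [CompactSpace X]
    [NormedAddCommGroup E] [ProperSpace E] {D : X → ℝ} (hD : Continuous D) {Ψ : X → E}
    (hΨ : ContinuousOn Ψ {p | 0 < D p}) (inj : Set.InjOn Ψ {p | 0 < D p})
    (surj : Set.SurjOn Ψ {p | 0 < D p} Set.univ)
    (proper : ∀ R, ∃ δ > 0, ∀ p, 0 < D p → ‖Ψ p‖ ≤ R → δ ≤ D p) :
    Nonempty ({p | 0 < D p} ≃ₜ E) := by
  set f : {p | 0 < D p} → E := Set.domRestrict {p | 0 < D p} Ψ with hf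
  have hcont : Continuous f := continuousOn_iff_continuous_domRestrict.1 hΨ
  have hproper : IsProperMap f := by
    refine isProperMap_iff_isCompact_preimage.2 ⟨hcont, fun K hK => ?_⟩
    obtain ⟨R, hR⟩ := hK.isBounded.exists_norm_le
    obtain ⟨δ, hδ, h⟩ := proper R
    rw [Subtype.isCompact_iff]
    have e : Subtype.val '' (f ⁻¹' K) = {p | δ ≤ D p} ∩ Ψ ⁻¹' K := by
      ext p
      constructor
      · rintro ⟨⟨p, hp⟩, hpK, rfl⟩
        exact ⟨h p hp (hR _ hpK), hpK⟩
      · rintro ⟨hp, hpK⟩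
        exact ⟨⟨p, lt_of_lt_of_le hδ hp⟩, hpK, rfl⟩
    rw [e]
    exact ((hΨ.mono fun p hp => lt_of_lt_of_le hδ hp).preimage_isClosed_of_isClosed
      (isClosed_le continuous_const hD) hK.isClosed).isCompact
  have hbij : Function.Bijective f :=
    ⟨Set.injOn_iff_injective.1 inj, fun y => by
      obtain ⟨p, hp, rfl⟩ := surj (Set.mem_univ y)
      exact ⟨⟨p, hp⟩, rfl⟩⟩
  exact ⟨(Equiv.ofBijective f hbij).toHomeomorphOfContinuousClosed hcont hproper.isClosedMap⟩

theorem nonempty_chartedSpace {X H : Type*} [TopologicalSpace X] [TopologicalSpace H]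
    (h : ∀ p : X, ∃ U : Set X, IsOpen U ∧ p ∈ U ∧ Nonempty (U ≃ₜ H)) :
    Nonempty (ChartedSpace H X) := by
  have h' : ∀ p : X, ∃ e : OpenPartialHomeomorph X H, p ∈ e.source := by
    intro p
    obtain ⟨U, hU, hp, ⟨f⟩⟩ := h p
    have : Nonempty U := ⟨⟨p, hp⟩⟩
    refine ⟨((⟨U, hU⟩ : TopologicalSpace.Opens X).openPartialHomeomorphSubtypeCoe
      this).symm.trans f.toOpenPartialHomeomorph, ?_⟩
    simpa using hp
  choose e he using h'
  exact ⟨{ atlas := Set.range e, chartAt := e, mem_chart_source := he,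
           chart_mem_atlas := fun p => ⟨p, rfl⟩ }⟩

section
variable {n : ℕ} {s g : Equiv.Perm (Fin n)}

/-- A function on the tetrahedra that takes equally spaced values on the unit circle along the
`g`-cycle of `t₀`, and vanishes elsewhere; `κ` is the angle of a step and `k` the length of the
cycle. -/
theorem exists_cycle_angle (g : Equiv.Perm (Fin n)) (t₀ : Fin n) :
    ∃ (κ : ℝ) (k : ℤ) (ω : Fin n → ℂ), 0 < κ ∧ κ * k = 2 * Real.pi ∧ (g ^ k) t₀ = t₀ ∧
      (∀ i : ℤ, ω ((g ^ i) t₀) = Complex.exp ((κ * i : ℝ) * Complex.I)) ∧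
      (∀ t, ω (g t) = Complex.exp (κ * Complex.I) * ω t) ∧
      ∀ t, ω t ≠ 0 → ∃ i : ℤ, (g ^ i) t₀ = t := by
  classical
  set k := Function.minimalPeriod (g • ·) t₀ with hk
  have hk0 : 0 < k := Nat.pos_of_ne_zero (MulAction.minimalPeriod_pos g t₀).out
  have hk0' : (0 : ℝ) < k := by exact_mod_cast hk0
  have hper : ∀ i : ℤ, (g ^ i) t₀ = t₀ ↔ (k : ℤ) ∣ i := fun i =>
    MulAction.zpow_smul_eq_iff_minimalPeriod_dvd (a := g) (b := t₀) (n := i)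
  set κ : ℝ := 2 * Real.pi / k with hκ
  have hκk : κ * k = 2 * Real.pi := div_mul_cancel₀ _ hk0'.ne'
  have hκ0 : 0 < κ := by positivity
  set ω : Fin n → ℂ := fun t => if h : ∃ i : ℤ, (g ^ i) t₀ = t then
    Complex.exp ((κ * h.choose : ℝ) * Complex.I) else 0 with hω
  have h1 : ∀ i : ℤ, ω ((g ^ i) t₀) = Complex.exp ((κ * i : ℝ) * Complex.I) := by
    intro i
    have h : ∃ i' : ℤ, (g ^ i') t₀ = (g ^ i) t₀ := ⟨i, rfl⟩
    simp only [hω, dif_pos h]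
    have h2 : (g ^ (h.choose - i)) t₀ = t₀ := by
      rw [sub_eq_neg_add, zpow_add, Equiv.Perm.mul_apply, h.choose_spec, ← Equiv.Perm.mul_apply,
        ← zpow_add, neg_add_cancel]; rfl
    obtain ⟨m, hm⟩ := (hper _).1 h2
    rw [Complex.exp_eq_exp_iff_exists_int]
    refine ⟨m, ?_⟩
    have h3 : (κ * h.choose : ℝ) = κ * i + m * (2 * Real.pi) := by
      rw [← hκk, show h.choose = i + k * m by omega]; push_cast; ring
    rw [h3]; push_cast; ring
  refine ⟨κ, k, ω, hκ0, by exact_mod_cast hκk, (hper k).2 dvd_rfl, h1, fun t => ?_, fun t ht => ?_⟩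
  · by_cases h : ∃ i : ℤ, (g ^ i) t₀ = t
    · obtain ⟨i, rfl⟩ := h
      rw [← Equiv.Perm.mul_apply, ← zpow_one_add, h1, h1, ← Complex.exp_add]
      push_cast; ring_nf
    · have h' : ¬ ∃ i : ℤ, (g ^ i) t₀ = g t := by
        rintro ⟨i, hi⟩
        refine h ⟨-1 + i, ?_⟩
        rw [zpow_add, Equiv.Perm.mul_apply, hi]; simp
      simp only [hω, dif_neg h, dif_neg h', mul_zero]
  · by_contra h
    exact ht (by simp only [hω, dif_neg h])

variable {c : ℝ} {t₀ : Fin n} {p q : (braidGluing s g).Realization} {κ : ℝ} {ω : Fin n → ℂ}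

theorem HasCoords.shift {i k : ℤ} {j : Fin 4} {b : Fin 4 → ℝ} (hk : (g ^ k) t₀ = t₀) (m : ℤ)
    (h : HasCoords c s g t₀ p j i b) : HasCoords c s g t₀ p j (i + k * m) b := by
  obtain ⟨t, x, h0, h1, h2⟩ := h
  refine ⟨t, x, h0, ?_, h2⟩
  rw [h1, zpow_add, Equiv.Perm.mul_apply, zpow_mul]
  congr 1
  exact ((Equiv.Perm.zpow_apply_eq_self_of_apply_eq_self hk m)).symm

theorem HasCylCoords.shift {k : ℤ} (hk : (g ^ k) t₀ = t₀) (m : ℤ) {r μ z : ℝ}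
    (h : HasCylCoords c s g t₀ p r μ z) : HasCylCoords c s g t₀ p r (μ + k * m * r) z := by
  obtain ⟨j, i, b, h, hr, hμ, hz⟩ := h
  refine ⟨j, i + k * m, b, h.shift hk m, hr, ?_, hz⟩
  rw [← hμ]; push_cast; ring

theorem HasCylCoords.radius_nonneg {r μ z : ℝ} (h : HasCylCoords c s g t₀ p r μ z) : 0 ≤ r := by
  obtain ⟨j, i, b, h, rfl, hμ, hz⟩ := h
  have := h.nonneg
  have h0 := this 0
  have h1 := this 1
  have h2 := this 2
  have h3 := this 3
  fin_cases j <;> simp [cornerRadius] <;> positivity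

theorem HasCylCoords.eq_zero_of_radius {μ z : ℝ} (h : HasCylCoords c s g t₀ p 0 μ z) : μ = 0 := by
  obtain ⟨j, i, b, h, hr, hμ, hz⟩ := h
  have := h.nonneg
  have h0 := this 0
  have h1 := this 1
  have h2 := this 2
  have h3 := this 3
  fin_cases j <;> simp [cornerRadius, cornerTwist] at hr hμ <;> linarith

theorem hasCoords_of_depth_pos {t : Fin n} {x : stdSimplex ℝ (Fin 4)} {j : Fin 4} {i : ℤ}
    (ht : (s ^ (j : ℕ)) t = (g ^ i) t₀) (hd : 0 < depth c j x.1) :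
    HasCoords c s g t₀ (Quot.mk _ (t, x)) j i
      fun l => if l = j then 0 else x.1 l / depth c j x.1 := by
  refine ⟨t, x, rfl, ht, hd, if_pos rfl, fun l hl => ?_⟩
  simp only [if_neg hl]
  field_simp

/-- `totalDepth` as a function on the realization. -/
noncomputable def realDepth (hsg : ∀ t, g (s (g t)) = s (s t)) (hc : 0 < c)
    (hω : ∀ t, ω (g t) = Complex.exp (κ * Complex.I) * ω t) : (braidGluing s g).Realization → ℝ :=
  Quot.lift (totalDepth c s ω) (totalDepth_respects hsg hc hω)

/-- `totalMap` as a function on the realization. -/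
noncomputable def realMap (hsg : ∀ t, g (s (g t)) = s (s t)) (hc : 0 < c)
    (hω : ∀ t, ω (g t) = Complex.exp (κ * Complex.I) * ω t) :
    (braidGluing s g).Realization → ℂ × ℝ :=
  Quot.lift (totalMap κ c s ω) (totalMap_respects hsg hc hω)

theorem continuous_realDepth (hsg : ∀ t, g (s (g t)) = s (s t)) (hc : 0 < c)
    (hω : ∀ t, ω (g t) = Complex.exp (κ * Complex.I) * ω t) : Continuous (realDepth hsg hc hω) :=
  continuous_quot_lift _ (continuous_totalDepth c s ω)

theorem continuous_realMap (hsg : ∀ t, g (s (g t)) = s (s t)) (hc : 0 < c)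
    (hω : ∀ t, ω (g t) = Complex.exp (κ * Complex.I) * ω t) : Continuous (realMap hsg hc hω) :=
  continuous_quot_lift _ (continuous_totalMap κ c s ω)

theorem exists_hasCoords_of_depth_pos (hsg : ∀ t, g (s (g t)) = s (s t)) (hc : 0 < c)
    (hω : ∀ t, ω (g t) = Complex.exp (κ * Complex.I) * ω t)
    (hω' : ∀ t, ω t ≠ 0 → ∃ i : ℤ, (g ^ i) t₀ = t) (hp : 0 < realDepth hsg hc hω p) :
    ∃ j i b, HasCoords c s g t₀ p j i b := by
  induction p using Quot.ind with | mk tx => ?_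
  obtain ⟨t, x⟩ := tx
  obtain ⟨j, -, hj⟩ := Finset.exists_lt_of_sum_lt (s := Finset.univ) (f := fun _ : Fin 4 => (0 : ℝ))
    (g := fun j => ‖ω ((s ^ (j : ℕ)) t)‖ * max (depth c j x.1) 0) (by
      rw [Finset.sum_const_zero]; exact hp)
  have h1 : ω ((s ^ (j : ℕ)) t) ≠ 0 := fun h => by simp [h] at hj
  have h2 : 0 < depth c j x.1 := by
    by_contra! h
    simp [max_eq_right h] at hj
  obtain ⟨i, hi⟩ := hω' _ h1
  exact ⟨j, i, _, hasCoords_of_depth_pos hi.symm h2⟩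

theorem realDepth_realMap (hsg : ∀ t, g (s (g t)) = s (s t)) (hc : 0 < c)
    (hω : ∀ t, ω (g t) = Complex.exp (κ * Complex.I) * ω t)
    (hω₀ : ∀ i : ℤ, ω ((g ^ i) t₀) = Complex.exp ((κ * i : ℝ) * Complex.I))
    {j : Fin 4} {i : ℤ} {b : Fin 4 → ℝ} (h : HasCoords c s g t₀ p j i b) :
    0 < realDepth hsg hc hω p ∧
    realDepth hsg hc hω p * (1 + ∑ l, (1 + cornerWeight c j l) * b l) = 1 ∧
    realMap hsg hc hω p = realDepth hsg hc hω p ^ 2 • cornerMap κ (ω ((g ^ i) t₀)) j b := by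
  obtain ⟨t, x, rfl, ht, hd, hj, hb⟩ := h
  have hn : ‖ω ((s ^ (j : ℕ)) t)‖ = 1 := by rw [ht, hω₀, Complex.norm_exp_ofReal_mul_I]
  have h1 : realDepth hsg hc hω (Quot.mk _ (t, x)) = depth c j x.1 := by
    change ∑ j : Fin 4, ‖ω ((s ^ (j : ℕ)) t)‖ * max (depth c j x.1) 0 = _
    rw [Finset.sum_eq_single j, hn, one_mul, max_eq_left hd.le]
    · intro l _ hl
      rw [max_eq_right (depth_nonpos_of_pos hc hl.symm x.2.1 hd), mul_zero]
    · simp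
  have h2 : realMap hsg hc hω (Quot.mk _ (t, x)) =
      depth c j x.1 • cornerMap κ (ω ((g ^ i) t₀)) j x.1 := by
    change ∑ j : Fin 4, (‖ω ((s ^ (j : ℕ)) t)‖ * max (depth c j x.1) 0) •
      cornerMap κ (ω ((s ^ (j : ℕ)) t)) j x.1 = _
    rw [Finset.sum_eq_single j, hn, one_mul, max_eq_left hd.le, ht]
    · intro l _ hl
      rw [max_eq_right (depth_nonpos_of_pos hc hl.symm x.2.1 hd), mul_zero, zero_smul]
    · simp
  refine ⟨by rwa [h1], by rw [h1]; exact depth_eq_of_coords x.2 hj hb, ?_⟩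
  rw [h1, h2, cornerMap_smul κ _ j hd.ne' hb, smul_smul, pow_two]

/-- In cylindrical coordinates the chart is the polar map; the unwrapped arc length absorbs the
reference direction. -/
theorem realMap_eq_polar (hsg : ∀ t, g (s (g t)) = s (s t)) (hc : 0 < c)
    (hω : ∀ t, ω (g t) = Complex.exp (κ * Complex.I) * ω t)
    (hω₀ : ∀ i : ℤ, ω ((g ^ i) t₀) = Complex.exp ((κ * i : ℝ) * Complex.I)) {r μ z : ℝ}
    (h : HasCylCoords c s g t₀ p r μ z) :
    0 < realDepth hsg hc hω p ∧
      realMap hsg hc hω p = realDepth hsg hc hω p ^ 2 • (polar κ r μ, z) := by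
  obtain ⟨j, i, b, h, rfl, rfl, rfl⟩ := h
  obtain ⟨h1, -, h2⟩ := realDepth_realMap hsg hc hω hω₀ h
  refine ⟨h1, ?_⟩
  rw [h2, cornerMap, hω₀, add_comm, polar_add]

theorem polar_injective (hκ : 0 < κ) {k : ℤ} (hκk : κ * k = 2 * Real.pi) {r μ μ' : ℝ} (hr : 0 < r)
    (h : polar κ r μ = polar κ r μ') : ∃ m : ℤ, μ = μ' + k * m * r := by
  have hr' : (r : ℂ) ≠ 0 := by exact_mod_cast hr.ne'
  have h1 := mul_left_cancel₀ hr' h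
  rw [Complex.exp_eq_exp_iff_exists_int] at h1
  obtain ⟨m, hm⟩ := h1
  refine ⟨m, ?_⟩
  have h2 : (((κ * (μ / r) : ℝ)) : ℂ) = ((κ * (μ' / r) + m * (2 * Real.pi) : ℝ) : ℂ) := by
    apply mul_right_cancel₀ Complex.I_ne_zero
    rw [hm]; push_cast; ring
  have h3 := Complex.ofReal_injective h2
  rw [← hκk] at h3
  have h4 : κ * (μ / r) = κ * ((μ' / r) + k * m) := by rw [h3]; ring
  have h5 := mul_left_cancel₀ hκ.ne' h4
  field_simp at h5
  linarith

theorem exists_polar_eq (hκ : 0 < κ) (w : ℂ) :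
    ∃ r μ : ℝ, 0 ≤ r ∧ (r = 0 → μ = 0) ∧ polar κ r μ = w := by
  refine ⟨‖w‖, ‖w‖ * (w.arg / κ), norm_nonneg w, fun h => by rw [h, zero_mul], ?_⟩
  rcases eq_or_ne w 0 with rfl | hw
  · simp [polar]
  · have : ‖w‖ ≠ 0 := norm_ne_zero_iff.2 hw
    rw [polar, mul_div_cancel_left₀ _ this, mul_div_cancel₀ _ hκ.ne',
      Complex.norm_mul_exp_arg_mul_I]

instance : CompactSpace (braidGluing s g).Realization := by
  have : CompactSpace (stdSimplex ℝ (Fin 4)) :=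
    isCompact_iff_compactSpace.1 (isCompact_stdSimplex ℝ _)
  exact inferInstanceAs (CompactSpace (Quot (braidGluing s g).Identified))

/-- The chart around the vertex at the corner `0` of `t₀` is `F / D ^ 2`, defined where `D` is
positive.  As `D` and `F` are continuous everywhere and determine the points of the chart, they
separate these from all other points. -/
theorem exists_vertex_chart (hsg : ∀ t, g (s (g t)) = s (s t)) (hc : 0 < c) (t₀ : Fin n) :
    ∃ (D : (braidGluing s g).Realization → ℝ) (F : (braidGluing s g).Realization → ℂ × ℝ),
      Continuous D ∧ Continuous F ∧ (∀ j i b p, HasCoords c s g t₀ p j i b → 0 < D p) ∧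
      (∀ p q, 0 < D p → D p = D q → F p = F q → p = q) ∧ Nonempty ({p | 0 < D p} ≃ₜ ℂ × ℝ) := by
  obtain ⟨κ, k, ω, hκ, hκk, hk, hω₀, hω, hω'⟩ := exists_cycle_angle g t₀
  set D := realDepth hsg hc hω with hD
  set F := realMap hsg hc hω with hF
  have hDc : Continuous D := continuous_realDepth hsg hc hω
  have hFc : Continuous F := continuous_realMap hsg hc hω
  set Ψ : (braidGluing s g).Realization → ℂ × ℝ := fun p => (D p ^ 2)⁻¹ • F p with hΨ
  have hΨeq : ∀ p r μ z, HasCylCoords c s g t₀ p r μ z → 0 < D p ∧ Ψ p = (polar κ r μ, z) := by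
    intro p r μ z h
    obtain ⟨h1, h2⟩ := realMap_eq_polar hsg hc hω hω₀ h
    refine ⟨h1, ?_⟩
    simp only [hΨ, hF, hD, h2]
    exact inv_smul_smul₀ (pow_pos h1 2).ne' _
  have inj : Set.InjOn Ψ {p | 0 < D p} := by
    intro p hp q hq hpq
    obtain ⟨j, i, b, h⟩ := exists_hasCoords_of_depth_pos hsg hc hω hω' hp
    obtain ⟨j', i', b', h'⟩ := exists_hasCoords_of_depth_pos hsg hc hω hω' hq
    have h1 : HasCylCoords c s g t₀ p _ _ _ := ⟨j, i, b, h, rfl, rfl, rfl⟩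
    have h2 : HasCylCoords c s g t₀ q _ _ _ := ⟨j', i', b', h', rfl, rfl, rfl⟩
    generalize cornerRadius j b = r, i * cornerRadius j b + cornerTwist j b = μ,
      cornerHeight j b = z at h1
    generalize cornerRadius j' b' = r', i' * cornerRadius j' b' + cornerTwist j' b' = μ',
      cornerHeight j' b' = z' at h2
    rw [(hΨeq _ _ _ _ h1).2, (hΨeq _ _ _ _ h2).2, Prod.mk.injEq] at hpq
    obtain ⟨e1, rfl⟩ := hpq
    have e2 := congrArg norm e1
    rw [norm_polar, norm_polar, abs_of_nonneg h1.radius_nonneg,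
      abs_of_nonneg h2.radius_nonneg] at e2
    subst e2
    rcases h1.radius_nonneg.eq_or_lt with rfl | hr
    · rw [h1.eq_zero_of_radius] at h1
      rw [h2.eq_zero_of_radius] at h2
      exact h1.unique hsg h2
    · obtain ⟨m, rfl⟩ := polar_injective hκ hκk hr e1
      exact h1.unique hsg (h2.shift hk m)
  refine ⟨D, F, hDc, hFc, fun j i b p h => (realDepth_realMap hsg hc hω hω₀ h).1,
    fun p q hp h1 h2 => ?_, ?_⟩
  · refine inj hp (show 0 < D q by rwa [← h1]) ?_
    simp only [hΨ, h1, h2]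
  · refine nonempty_homeomorph_of_proper hDc (Ψ := Ψ) ?_ inj ?_ ?_
    · refine ContinuousOn.smul (ContinuousOn.inv₀ (hDc.pow 2).continuousOn fun p hp => ?_)
        hFc.continuousOn
      exact (pow_pos (show 0 < D p from hp) 2).ne'
    · rintro ⟨w, z⟩ -
      obtain ⟨r, μ, hr, hμ, rfl⟩ := exists_polar_eq hκ w
      obtain ⟨p, hp⟩ := exists_hasCylCoords (s := s) (g := g) (t₀ := t₀) (z := z) hc μ hr hμ
      obtain ⟨h1, h2⟩ := hΨeq _ _ _ _ hp
      exact ⟨p, h1, h2⟩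
    · intro R
      set K := 1 + (c + c⁻¹) with hK
      have hK0 : 0 < K := by positivity
      refine ⟨1 / (1 + K * |R|), by positivity, fun p hp hR => ?_⟩
      obtain ⟨j, i, b, h⟩ := exists_hasCoords_of_depth_pos hsg hc hω hω' hp
      obtain ⟨h1, h2, h3⟩ := realDepth_realMap hsg hc hω hω₀ h
      have h4 : Ψ p = cornerMap κ (ω ((g ^ i) t₀)) j b := by
        simp only [hΨ, hF, hD, h3]
        exact inv_smul_smul₀ (pow_pos h1 2).ne' _
      have hn : ‖ω ((g ^ i) t₀)‖ = 1 := by rw [hω₀, Complex.norm_exp_ofReal_mul_I]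
      have h5 : ∑ l, (1 + cornerWeight c j l) * b l ≤ K * |R| := by
        calc ∑ l, (1 + cornerWeight c j l) * b l ≤ ∑ l, K * (if l = j then 0 else b l) := by
              refine Finset.sum_le_sum fun l _ => ?_
              split_ifs with hl
              · rw [hl, h.eq_zero, mul_zero, mul_zero]
              · have := cornerWeight_le hc j l
                exact mul_le_mul_of_nonneg_right (by linarith) (h.nonneg l)
          _ = K * ‖Ψ p‖ := by rw [h4, norm_cornerMap κ hn j h.nonneg, Finset.mul_sum]
          _ ≤ K * |R| := mul_le_mul_of_nonneg_left (hR.trans (le_abs_self R)) hK0.le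
      rw [div_le_iff₀ (by positivity)]
      calc 1 = D p * (1 + ∑ l, (1 + cornerWeight c j l) * b l) := h2.symm
        _ ≤ D p * (1 + K * |R|) := mul_le_mul_of_nonneg_left (by linarith) h1.le

theorem exists_chart_at (hsg : ∀ t, g (s (g t)) = s (s t)) (p : (braidGluing s g).Realization) :
    ∃ (D : (braidGluing s g).Realization → ℝ) (F : (braidGluing s g).Realization → ℂ × ℝ),
      Continuous D ∧ Continuous F ∧ 0 < D p ∧
      (∀ p q, 0 < D p → D p = D q → F p = F q → p = q) ∧ Nonempty ({p | 0 < D p} ≃ₜ ℂ × ℝ) := by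
  induction p using Quot.ind with | mk tx => ?_
  obtain ⟨t, x⟩ := tx
  obtain ⟨c, hc, j, hj⟩ := exists_depth_pos x.2
  obtain ⟨D, F, hD, hF, h1, h2⟩ := exists_vertex_chart hsg hc ((s ^ (j : ℕ)) t)
  exact ⟨D, F, hD, hF, h1 j 0 _ _ (hasCoords_of_depth_pos (by simp) hj), h2⟩

theorem connectedSpace_realization (hn : 0 < n)
    (htrans : ∀ P : Fin n → Prop, (∀ t, P t → P (s t)) → (∀ t, P t → P
    (g t)) → ∀ t t', P t → P t') :
    ConnectedSpace (braidGluing s g).Realization := by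
  set G := braidGluing s g with hG
  have hΔ : (stdSimplex ℝ (Fin 4)).Nonempty := ⟨_, single_mem_stdSimplex ℝ 0⟩
  have : PreconnectedSpace G.Realization := by
    refine preconnectedSpace_of_forall_constant fun f hf => ?_
    have hmk : Continuous (fun tx : Fin n × stdSimplex ℝ (Fin 4) => f (Quot.mk _ tx)) :=
      hf.comp continuous_quot_mk
    have h1 : ∀ t (x y : stdSimplex ℝ (Fin 4)), f (Quot.mk _ (t, x)) = f (Quot.mk _ (t, y)) := by
      intro t x y
      have : PreconnectedSpace (stdSimplex ℝ (Fin 4)) :=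
        Subtype.preconnectedSpace (convex_stdSimplex ℝ (Fin 4)).isPreconnected
      exact PreconnectedSpace.constant inferInstance (f := fun x => f (Quot.mk _ (t, x)))
        (hmk.comp (by fun_prop))
    have h2 : ∀ t v, ∃ x y, f (Quot.mk _ (t, x)) = f (Quot.mk _ (G.adj t v, y)) := by
      intro t v
      obtain ⟨w, hw⟩ : ∃ w : Fin 4, w ≠ v := exists_ne v
      refine ⟨⟨_, single_mem_stdSimplex ℝ w⟩, ⟨_, single_mem_stdSimplex ℝ (G.perm t v w)⟩,
        congrArg f (Quot.sound ⟨v, ?_, rfl, fun u => ?_⟩)⟩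
      · exact Pi.single_eq_of_ne hw.symm 1
      · simp [Pi.single_apply]
    have h3 : ∀ t v x y, f (Quot.mk _ (t, x)) = f (Quot.mk _ (G.adj t v, y)) := by
      intro t v x y
      obtain ⟨x', y', h⟩ := h2 t v
      rw [h1 t x x', h, h1 _ y' y]
    intro p q
    induction p using Quot.ind with | mk p => ?_
    induction q using Quot.ind with | mk q => ?_
    obtain ⟨t, x⟩ := p
    obtain ⟨t', y⟩ := q
    refine htrans (fun u => ∀ z, f (Quot.mk _ (t, x)) = f (Quot.mk _ (u, z))) ?_ ?_ t t' (h1 t x) y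
    · intro u hu z
      rw [hu z]; exact h3 u 0 z z
    · intro u hu z
      rw [hu z]; exact h3 u 1 z z
  obtain ⟨x, hx⟩ := hΔ
  exact { toNonempty := ⟨Quot.mk _ (⟨0, hn⟩, ⟨x, hx⟩)⟩ }

/-- Transitive permutation representations of the braid group on three strands give 3-manifold
triangulations. -/
theorem isConnectedClosedThreeManifold_braidGluing (hn : 0 < n) (hsg : ∀ t, g (s (g t)) = s (s t))
    (htrans : ∀ P : Fin n → Prop, (∀ t, P t → P (s t)) → (∀ t, P t → P
    (g t)) → ∀ t t', P t → P t') :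
    IsConnectedClosedThreeManifold (braidGluing s g).Realization := by
  have hcharts : Nonempty (ChartedSpace (EuclideanSpace ℝ (Fin 3)) (braidGluing s
    g).Realization) := by
    refine nonempty_chartedSpace fun p => ?_
    obtain ⟨D, F, hD, hF, hp, -, ⟨e⟩⟩ := exists_chart_at hsg p
    have e' : (ℂ × ℝ) ≃L[ℝ] EuclideanSpace ℝ (Fin 3) :=
      ContinuousLinearEquiv.ofFinrankEq (by simp [Module.finrank_prod,
        Complex.finrank_real_complex])
    exact ⟨{p | 0 < D p}, isOpen_lt continuous_const hD, hp, ⟨e.trans e'.toHomeomorph⟩⟩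
  refine ⟨connectedSpace_realization hn htrans, inferInstance, ?_, ⟨fun p q hpq => ?_⟩, hcharts⟩
  · obtain ⟨h⟩ := hcharts
    exact ChartedSpace.secondCountable_of_sigmaCompact (EuclideanSpace ℝ (Fin 3)) _
  · obtain ⟨D, F, hD, hF, hp, hinj, -⟩ := exists_chart_at hsg p
    refine separated_by_continuous (hD.prodMk hF) fun h => hpq ?_
    rw [Prod.mk.injEq] at h
    exact hinj p q hp h.1 h.2

end

/-! ### Transitive pairs of permutations -/

/-- The group generated by `s` and `x` acts transitively.  On a finite type closure under the
inverses is automatic. -/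
def IsTransitivePair {T : Type*} (s x : Equiv.Perm T) : Prop :=
  ∀ P : T → Prop, (∀ t, P t → P (s t)) → (∀ t, P t → P (x t)) → ∀ t t', P t → P t'

/-- There is a transitive pair of permutations `s, x` of `T` with `s ^ 3 = 1` and `x ^ 2 = 1`, and a
set of `f` fixed points of `x`. -/
def HasFrame (T : Type*) (f : ℕ) : Prop :=
  ∃ (s x : Equiv.Perm T) (S : Finset T), (∀ t, s (s (s t)) = t) ∧ (∀ t, x (x t) = t) ∧
    IsTransitivePair s x ∧ S.card = f ∧ ∀ t ∈ S, x t = t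

theorem HasFrame.congr {T T' : Type*} {f : ℕ} (e : T ≃ T') (h : HasFrame T f) : HasFrame T' f := by
  obtain ⟨s, x, S, hs, hx, htr, hS, hfix⟩ := h
  refine ⟨e.permCongr s, e.permCongr x, S.map e.toEmbedding, fun t => ?_, fun t => ?_,
    fun P h1 h2 t t' ht => ?_, by rw [Finset.card_map, hS], fun t ht => ?_⟩
  · simp [hs]
  · simp [hx]
  · have := htr (fun t => P (e t)) (fun t ht => by simpa using h1 _ ht)
      (fun t ht => by simpa using h2 _ ht) (e.symm t) (e.symm t') (by simpa using ht)
    simpa using this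
  · obtain ⟨u, hu, rfl⟩ := Finset.mem_map.1 ht
    simp [hfix u hu]

/-- A new cycle of `s`, of length `k + 1 ∈ {1, 3}`, is attached by letting `x` exchange one of its
points with a former fixed point of `x`; the `k` other new points are fixed by `x`. -/
theorem HasFrame.attach {T : Type*} {f k : ℕ} (h : HasFrame T (f + 1))
    (hk : ∀ i : Fin (k + 1), finRotate _ (finRotate _ (finRotate _ i)) = i)
    (hk' : ∀ i j : Fin (k + 1), j = i ∨ j = finRotate _ i ∨ j = finRotate _ (finRotate _ i)) :
    HasFrame (T ⊕ Fin (k + 1)) (f + k) := by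
  classical
  obtain ⟨s, x, S, hs, hx, htr, hS, hfix⟩ := h
  obtain ⟨a, ha⟩ : S.Nonempty := Finset.card_pos.1 (by omega)
  set x' : Equiv.Perm (T ⊕ Fin (k + 1)) :=
    Equiv.sumCongr x (Equiv.refl _) * Equiv.swap (Sum.inl a) (Sum.inr 0) with hx'
  have xa : x' (Sum.inl a) = Sum.inr 0 := by simp [hx']
  have x0 : x' (Sum.inr 0) = Sum.inl a := by simp [hx', hfix a ha]
  have xl : ∀ t, t ≠ a → x' (Sum.inl t) = Sum.inl (x t) := fun t ht => by
    rw [hx', Equiv.Perm.mul_apply, Equiv.swap_apply_of_ne_of_ne (by simpa using ht) (by simp)]; rfl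
  have xr : ∀ i, i ≠ 0 → x' (Sum.inr i) = Sum.inr i := fun i hi => by
    rw [hx', Equiv.Perm.mul_apply, Equiv.swap_apply_of_ne_of_ne (by simp) (by simpa using hi)]; rfl
  refine ⟨Equiv.sumCongr s (finRotate _), x', (S.erase a).disjSum (Finset.univ.erase 0),
    ?_, ?_, ?_, ?_, ?_⟩
  · rintro (t | i)
    · simp [hs]
    · simpa using hk i
  · rintro (t | i)
    · by_cases ht : t = a
      · rw [ht, xa, x0]
      · rw [xl t ht, xl _ fun h => ht (by rw [← hx t, h, hfix a ha]), hx]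
    · by_cases hi : i = 0
      · rw [hi, x0, xa]
      · rw [xr i hi, xr i hi]
  · intro P h1 h2
    have hT : ∀ t t', P (Sum.inl t) → P (Sum.inl t') := by
      refine htr (fun t => P (Sum.inl t)) (fun t ht => h1 _ ht) fun t ht => ?_
      by_cases hta : t = a
      · rwa [hta, hfix a ha, ← hta]
      · rw [← xl t hta]; exact h2 _ ht
    have hR : ∀ i, P (Sum.inr i) → P (Sum.inr (finRotate _ i)) := fun i hi => h1 _ hi
    have hI : ∀ i j : Fin (k + 1), P (Sum.inr i) → P (Sum.inr j) := by
      intro i j hi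
      rcases hk' i j with rfl | rfl | rfl
      exacts [hi, hR _ hi, hR _ (hR _ hi)]
    have hub : ∀ t, (P t → P (Sum.inl a)) ∧ (P (Sum.inl a) → P t) := by
      rintro (t | i)
      · exact ⟨hT t a, hT a t⟩
      · refine ⟨fun h => ?_, fun h => hI 0 i ?_⟩
        · rw [← x0]; exact h2 _ (hI i 0 h)
        · rw [← xa]; exact h2 _ h
    exact fun t t' ht => (hub t').2 ((hub t).1 ht)
  · rw [Finset.card_disjSum, Finset.card_erase_of_mem ha, hS,
      Finset.card_erase_of_mem (Finset.mem_univ _)]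
    simp
  · rintro (t | i) ht
    · rw [Finset.inl_mem_disjSum, Finset.mem_erase] at ht
      rw [xl t ht.1, hfix t ht.2]
    · rw [Finset.inr_mem_disjSum, Finset.mem_erase] at ht
      exact xr i ht.1

theorem hasFrame_one : HasFrame (Fin 1) 1 :=
  ⟨1, 1, Finset.univ, fun _ => rfl, fun _ => rfl,
    fun P _ _ t t' ht => by rwa [Subsingleton.elim t' t],
    rfl, fun _ _ => rfl⟩

theorem HasFrame.add_one {n f : ℕ} (h : HasFrame (Fin n) (f + 1)) : HasFrame (Fin (n + 1)) f :=
  (h.attach (k := 0) (by decide) (by decide)).congr finSumFinEquiv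

theorem HasFrame.add_three {n f : ℕ} (h : HasFrame (Fin n) (f + 1)) :
    HasFrame (Fin (n + 3)) (f + 2) :=
  (h.attach (k := 2) (by decide) (by decide)).congr finSumFinEquiv

theorem exists_hasFrame {n : ℕ} (hn : 6 ≤ n) : ∃ f, n ≤ 3 * f + 6 ∧ HasFrame (Fin n) f := by
  have h1 : ∀ m, HasFrame (Fin (3 * m + 1)) (m + 1) := by
    intro m
    induction m with
    | zero => exact hasFrame_one
    | succ m ih => exact ih.add_three
  obtain ⟨m, rfl | rfl | rfl⟩ : ∃ m, n = 3 * m + 1 ∨ n = 3 * m + 2 ∨ n = 3 * (m + 1) + 3 :=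
    ⟨if n % 3 = 0 then n / 3 - 2 else n / 3, by split_ifs <;> omega⟩
  · exact ⟨m + 1, by omega, h1 m⟩
  · exact ⟨m, by omega, (h1 m).add_one⟩
  · exact ⟨m, by omega, (h1 (m + 1)).add_one.add_one⟩

/-! ### Many triangulations -/

/-- The involution that exchanges two copies of `Fin h` by the bijection `π`. -/
def exchange {h : ℕ} (π : Equiv.Perm (Fin h)) : Equiv.Perm (Fin h ⊕ Fin h) :=
  (Equiv.sumComm _ _).trans (Equiv.sumCongr π.symm π)

theorem exchange_exchange {h : ℕ} (π : Equiv.Perm (Fin h)) (u : Fin h ⊕ Fin h) :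
    exchange π (exchange π u) = u := by
  rcases u with i | i <;> simp [exchange]

theorem exchange_injective {h : ℕ} : Function.Injective (exchange (h := h)) := by
  intro π π' e
  ext i
  have := DFunLike.congr_fun e (Sum.inl i)
  simp [exchange] at this
  rw [this]

section
variable {n h : ℕ} (s x : Equiv.Perm (Fin n)) (ι : Fin h ⊕ Fin h ↪ Fin n)

/-- The permutation `x` changed by an exchange on the range of `ι`, which consists of fixed points
of `x` in what follows. -/
noncomputable def withExchange (π : Equiv.Perm (Fin h)) : Equiv.Perm (Fin n) :=
  x * (exchange π).viaEmbedding ι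

variable {s x ι}

theorem withExchange_of_notMem (π : Equiv.Perm (Fin h)) {t : Fin n} (ht : t ∉ Set.range ι) :
    withExchange x ι π t = x t := by
  rw [withExchange, Equiv.Perm.mul_apply, Equiv.Perm.viaEmbedding_apply_of_notMem _ _ _ ht]

theorem withExchange_apply (hfix : ∀ u, x (ι u) = ι u) (π : Equiv.Perm (Fin h))
    (u : Fin h ⊕ Fin h) :
    withExchange x ι π (ι u) = ι (exchange π u) := by
  rw [withExchange, Equiv.Perm.mul_apply, Equiv.Perm.viaEmbedding_apply, hfix]

theorem withExchange_withExchange (hx : ∀ t, x (x t) = t) (hfix : ∀ u, x (ι u) = ι u)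
    (π : Equiv.Perm (Fin h)) (t : Fin n) : withExchange x ι π (withExchange x ι π t) = t := by
  by_cases ht : t ∈ Set.range ι
  · obtain ⟨u, rfl⟩ := ht
    rw [withExchange_apply hfix, withExchange_apply hfix, exchange_exchange]
  · have ht' : x t ∉ Set.range ι := by
      rintro ⟨u, hu⟩
      exact ht ⟨u, by rw [← hx t, ← hu, hfix]⟩
    rw [withExchange_of_notMem π ht, withExchange_of_notMem π ht', hx]

theorem withExchange_injective (hfix : ∀ u, x (ι u) = ι u) :
    Function.Injective (withExchange x ι) := by
  intro π π' e
  refine exchange_injective (Equiv.ext fun u => ι.injective ?_)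
  rw [← withExchange_apply hfix, ← withExchange_apply hfix, e]

theorem isTransitivePair_withExchange (htr : IsTransitivePair s x) (hfix : ∀ u, x (ι u) = ι u)
    (π : Equiv.Perm (Fin h)) : IsTransitivePair s (withExchange x ι π) := by
  intro P h1 h2
  refine htr P h1 fun t ht => ?_
  by_cases htι : t ∈ Set.range ι
  · obtain ⟨u, rfl⟩ := htι
    rwa [hfix]
  · rw [← withExchange_of_notMem π htι]; exact h2 t ht

theorem isConnectedClosedThreeManifold_of_involution (hn : 0 < n) (hs : ∀ t, s (s (s t)) = t)
    (hx : ∀ t, x (x t) = t)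
    (htr : IsTransitivePair s x) :
    IsConnectedClosedThreeManifold (braidGluing s (x * s⁻¹)).Realization := by
  refine isConnectedClosedThreeManifold_braidGluing hn (fun t => ?_) fun P h1 h2 => ?_
  · have h3 : s.symm t = s (s t) := by rw [Equiv.symm_apply_eq, hs]
    simp [hx, h3]
  · refine htr P h1 fun t ht => ?_
    have := h2 _ (h1 t ht)
    simpa using this

/-- The triangulation defined by `s` and `withExchange x ι π`. -/
noncomputable def exchangeTriangulation (hn : 0 < n) (hs : ∀ t, s (s (s t)) = t)
    (hx : ∀ t, x (x t) = t) (htr : IsTransitivePair s x) (hfix : ∀ u, x (ι u) = ι u)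
    (π : Equiv.Perm (Fin h)) : ThreeManifoldTriangulation n :=
  ⟨braidGluing s (withExchange x ι π * s⁻¹), isConnectedClosedThreeManifold_of_involution hn hs
    (withExchange_withExchange hx hfix π) (isTransitivePair_withExchange htr hfix π)⟩

theorem exchangeTriangulation_adj_zero (hn : 0 < n) (hs : ∀ t, s (s (s t)) = t)
    (hx : ∀ t, x (x t) = t) (htr : IsTransitivePair s x) (hfix : ∀ u, x (ι u) = ι u)
    (π : Equiv.Perm (Fin h)) (t : Fin n) :
    (exchangeTriangulation hn hs hx htr hfix π).1.adj t 0 = s t :=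
  rfl

theorem exchangeTriangulation_adj_one (hn : 0 < n) (hs : ∀ t, s (s (s t)) = t)
    (hx : ∀ t, x (x t) = t) (htr : IsTransitivePair s x) (hfix : ∀ u, x (ι u) = ι u)
    (π : Equiv.Perm (Fin h)) (t : Fin n) :
    (exchangeTriangulation hn hs hx htr hfix π).1.adj (s t) 1 = withExchange x ι π t := by
  change (withExchange x ι π * s⁻¹) (s t) = withExchange x ι π t
  rw [Equiv.Perm.mul_apply, Equiv.Perm.coe_inv, Equiv.symm_apply_apply]

theorem exchangeTriangulation_perm (hn : 0 < n) (hs : ∀ t, s (s (s t)) = t)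
    (hx : ∀ t, x (x t) = t) (htr : IsTransitivePair s x) (hfix : ∀ u, x (ι u) = ι u)
    (π : Equiv.Perm (Fin h)) (t : Fin n) (v : Fin 4) :
    (exchangeTriangulation hn hs hx htr hfix π).1.perm t v = facePerm v :=
  rfl

/-- Among the `h!` triangulations at most `24 * n` are isomorphic to a given one: an isomorphism is
determined by what it does on one tetrahedron, because it propagates along the gluings that all
these triangulations share, and then it determines the other gluings. -/
theorem factorial_le (hn : 0 < n) (hs : ∀ t, s (s (s t)) = t)
    (hx : ∀ t, x (x t) = t) (htr : IsTransitivePair s x) (hfix : ∀ u, x (ι u) = ι u) :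
    h.factorial ≤ ThreeManifoldTriangulation.numIsoClasses n * (n * 24) := by
  set T := exchangeTriangulation hn hs hx htr hfix with hT
  have hiso : ∀ π, ThreeManifoldTriangulation.Isomorphic (T π)
      (Quotient.out (⟦T π⟧ : ThreeManifoldTriangulation.IsoClass n)) := fun π =>
    (ThreeManifoldTriangulation.isomorphic_equivalence n).symm (Quotient.mk_out (T π))
  have adj0 : ∀ π t, (T π).1.adj t 0 = s t := exchangeTriangulation_adj_zero hn hs hx htr hfix
  have adj1 : ∀ π t, (T π).1.adj (s t) 1 = withExchange x ι π t :=
    exchangeTriangulation_adj_one hn hs hx htr hfix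
  have hperm : ∀ π t v, (T π).1.perm t v = facePerm v :=
    exchangeTriangulation_perm hn hs hx htr hfix
  clear_value T
  choose σ τ hστ using hiso
  set t₀ : Fin n := ⟨0, hn⟩
  let F : Equiv.Perm (Fin h) →
      ThreeManifoldTriangulation.IsoClass n × (Fin n × Equiv.Perm (Fin 4)) :=
    fun π => (⟦T π⟧, σ π t₀, τ π t₀)
  have hF : Function.Injective F := by
    intro π π' e
    simp only [F, Prod.mk.injEq] at e
    obtain ⟨e1, e2, e3⟩ := e
    have h1 := hστ π
    have h2 := hστ π'
    rw [← e1] at h2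
    generalize Quotient.out (⟦T π⟧ : ThreeManifoldTriangulation.IsoClass n) = R at h1 h2
    -- two isomorphisms to `R` that agree on a tetrahedron agree on the one behind a common gluing
    have step : ∀ t v, σ π t = σ π' t → τ π t = τ π' t →
        σ π ((T π).1.adj t v) = σ π' ((T π').1.adj t v) := by
      intro t v h3 h4
      rw [← (h1 t v).1, ← (h2 t v).1, h3, h4]
    have step' : ∀ t v, σ π t = σ π' t → τ π t = τ π' t → (T π).1.adj t v = (T π').1.adj t v →
        σ π ((T π).1.adj t v) = σ π' ((T π).1.adj t v) ∧
          τ π ((T π).1.adj t v) = τ π' ((T π).1.adj t v) := by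
      intro t v h3 h4 h5
      refine ⟨by rw [step t v h3 h4, h5], Equiv.ext fun w => ?_⟩
      have h6 := (h1 t v).2 ((facePerm v).symm w)
      have h7 := (h2 t v).2 ((facePerm v).symm w)
      rw [← h3, ← h4, h6, hperm, hperm, Equiv.apply_symm_apply, ← h5] at h7
      exact h7
    have stepS : ∀ t, σ π t = σ π' t → τ π t = τ π' t →
        σ π (s t) = σ π' (s t) ∧ τ π (s t) = τ π' (s t) := by
      intro t h3 h4
      have := step' t 0 h3 h4 (by rw [adj0, adj0])
      rwa [adj0] at this
    have all : ∀ t, σ π t = σ π' t ∧ τ π t = τ π' t := by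
      intro t
      refine htr (fun t => σ π t = σ π' t ∧ τ π t = τ π' t) (fun t ⟨h3, h4⟩ => stepS t h3 h4) ?_
        t₀ t ⟨e2, e3⟩
      rintro t ⟨h3, h4⟩
      by_cases ht : t ∈ Set.range ι
      · obtain ⟨u, rfl⟩ := ht
        rw [hfix]; exact ⟨h3, h4⟩
      · obtain ⟨h5, h6⟩ := stepS t h3 h4
        have := step' (s t) 1 h5 h6
          (by rw [adj1, adj1, withExchange_of_notMem π ht, withExchange_of_notMem π' ht])
        rwa [adj1, withExchange_of_notMem π ht] at this
    refine withExchange_injective hfix (Equiv.ext fun t => ?_)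
    have h3 := step (s t) 1 (all _).1 (all _).2
    rw [← (all _).1, adj1, adj1] at h3
    exact (σ π).injective h3
  have h1 := Nat.card_le_card_of_injective F hF
  rw [Nat.card_prod, Nat.card_prod] at h1
  simpa [Nat.card_eq_fintype_card, Fintype.card_perm, Nat.factorial,
    ThreeManifoldTriangulation.numIsoClasses] using h1

end

/-! ### The bounds -/

theorem numIsoClasses_le (n : ℕ) : ThreeManifoldTriangulation.numIsoClasses n ≤
    ((n * 24) ^ 4) ^ n := by
  have h1 : Function.Injective
      fun (G : FaceGluing n) (t : Fin n) (v : Fin 4) => (G.adj t v, G.perm t v) := by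
    intro G H h
    refine FaceGluing.ext ?_ ?_ <;> funext t v
    · exact congrArg Prod.fst (congrFun (congrFun h t) v)
    · exact congrArg Prod.snd (congrFun (congrFun h t) v)
  have := Finite.of_injective _ h1
  calc ThreeManifoldTriangulation.numIsoClasses n
      ≤ Nat.card (ThreeManifoldTriangulation n) :=
        Nat.card_le_card_of_surjective _ Quotient.mk_surjective
    _ ≤ Nat.card (FaceGluing n) := Nat.card_le_card_of_injective _ Subtype.val_injective
    _ ≤ Nat.card (Fin n → Fin 4 → Fin n × Equiv.Perm (Fin 4)) := Nat.card_le_card_of_injective _ h1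
    _ = ((n * 24) ^ 4) ^ n := by simp [Fintype.card_perm, Nat.factorial]

theorem exists_factorial_le {n : ℕ} (hn : 18 ≤ n) : ∃ h, n ≤ 12 * h ∧
    h.factorial ≤ ThreeManifoldTriangulation.numIsoClasses n * (n * 24) := by
  obtain ⟨f, hf, s, x, S, hs, hx, htr, hS, hfix⟩ := exists_hasFrame (n := n) (by omega)
  obtain ⟨e⟩ : Nonempty (Fin (f / 2) ⊕ Fin (f / 2) ↪ S) := by
    apply Function.Embedding.nonempty_of_card_le
    simp [hS]; omega
  exact ⟨f / 2, by omega, factorial_le (ι := e.trans (Function.Embedding.subtype _)) (by omega) hs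
    hx
    htr fun u => hfix _ (e u).2⟩

theorem mainTheorem5 :
    ∃ c C : ℝ, 0 < c ∧ 0 < C ∧ ∃ N : ℕ, ∀ n : ℕ, N ≤ n →
      Real.exp (c * (n * Real.log n)) ≤ (ThreeManifoldTriangulation.numIsoClasses n : ℝ) ∧
        (ThreeManifoldTriangulation.numIsoClasses n : ℝ) ≤ Real.exp (C * (n * Real.log n)) := by
  refine ⟨1 / 48, 8, by norm_num, by norm_num, max 96 ⌈Real.exp 8⌉₊, fun n hn => ?_⟩
  have hn96 : 96 ≤ n := (le_max_left _ _).trans hn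
  have hn' : (96 : ℝ) ≤ n := by exact_mod_cast hn96
  have hn0 : (0 : ℝ) < n := by linarith
  have hL : 8 ≤ Real.log n := by
    rw [Real.le_log_iff_exp_le hn0]
    exact Nat.ceil_le.1 ((le_max_right _ _).trans hn)
  have h24 : Real.log 24 ≤ 4 := by
    rw [Real.log_le_iff_le_exp (by norm_num), show (4 : ℝ) = (4 : ℕ) * 1 by norm_num,
      Real.exp_nat_mul]
    have := Real.exp_one_gt_d9
    calc (24 : ℝ) ≤ 2.7 ^ 4 := by norm_num
      _ ≤ Real.exp 1 ^ 4 := by gcongr; linarith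
  have h12 : Real.log 12 ≤ 3 := by
    rw [Real.log_le_iff_le_exp (by norm_num), show (3 : ℝ) = (3 : ℕ) * 1 by norm_num,
      Real.exp_nat_mul]
    have := Real.exp_one_gt_d9
    calc (12 : ℝ) ≤ 2.7 ^ 3 := by norm_num
      _ ≤ Real.exp 1 ^ 3 := by gcongr; linarith
  have hlog24 : Real.log (n * 24) ≤ 2 * Real.log n := by
    rw [Real.log_mul hn0.ne' (by norm_num)]; linarith
  constructor
  · obtain ⟨h, hh, hfac⟩ := exists_factorial_le (n := n) (by omega)
    set V := ThreeManifoldTriangulation.numIsoClasses n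
    have hh' : (n : ℝ) ≤ 12 * h := by exact_mod_cast hh
    have hh0 : (0 : ℝ) < h := by linarith
    have hfac' : (h.factorial : ℝ) ≤ V * (n * 24) := by exact_mod_cast hfac
    have hfpos : (0 : ℝ) < h.factorial := by exact_mod_cast h.factorial_pos
    have hV : (0 : ℝ) < V := pos_of_mul_pos_left (hfpos.trans_le hfac') (by positivity)
    -- `h log h - h ≤ log h!`, from `h ^ h / h! ≤ exp h`
    have h1 : h * Real.log h - h ≤ Real.log h.factorial := by
      have h2 := Real.log_le_log (by positivity) (Real.pow_div_factorial_le_exp (h : ℝ) hh0.le h)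
      rw [Real.log_exp, Real.log_div (by positivity) hfpos.ne', Real.log_pow] at h2
      linarith
    have h2 : Real.log h.factorial ≤ Real.log V + Real.log (n * 24) := by
      rw [← Real.log_mul hV.ne' (by positivity)]
      exact Real.log_le_log hfpos hfac'
    have h3 : Real.log n - 3 ≤ Real.log h := by
      have h4 := Real.log_le_log hn0 hh'
      rw [Real.log_mul (by norm_num) hh0.ne'] at h4
      linarith
    have h4 : (n / 12 : ℝ) * (Real.log n / 2) ≤ h * (Real.log h - 1) :=
      mul_le_mul (by linarith) (by linarith) (by linarith) hh0.le
    have h5 : 96 * Real.log n ≤ n * Real.log n := mul_le_mul_of_nonneg_right hn' (by linarith)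
    rw [← Real.le_log_iff_exp_le hV]
    linarith
  · have h1 : (ThreeManifoldTriangulation.numIsoClasses n : ℝ) ≤ ((n * 24) ^ 4) ^ n := by
      exact_mod_cast numIsoClasses_le n
    refine h1.trans ?_
    rw [← Real.log_le_iff_le_exp (by positivity), Real.log_pow, Real.log_pow]
    have := mul_le_mul_of_nonneg_left hlog24 hn0.le
    push_cast
    linarith
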